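/- Throughout, $n \ge 1$ and "unconditional" refers to the canonical basis of $\mathbb{R}^n$: a subset of $\mathbb{R}^n$, or a Borel measure on $\mathbb{R}^n$, is unconditional if it is invariant under all maps $(x_1,\dots,x_n) \mapsto (\varepsilon_1 x_1,\dots,\varepsilon_n x_n)$ with $\varepsilon \in \{-1,1\}^n$. A convex body is a compact convex set with the origin in its interior, and $h_A(u) = \max_{x\in A}\langle x,u\rangle$ is the support function of $A$. For $a,b \ge 0$ and $\lambda\in[0,1]$ put $M_s^\lambda(a,b) = ((1-\lambda)a^s+\lambda b^s)^{1/s}$ for $s \in \mathbb{R}\setminus\{0\}$ (for $s<0$ with the conventions $0^{s}=+\infty$, $0\cdot\infty=0$, $(+\infty)^{1/s}=0$), $M_0^\lambda(a,b)=a^{1-\lambda}b^\lambda$, $M_{-\infty}^\lambda(a,b)=\min(a,b)$, $M_{+\infty}^\lambda(a,b)=\max(a,b)$. A function $f:\mathbb{R}^n\to[0,\infty)$ is $\alpha$-concave, $\alpha\in[-\infty,+\infty]$, if $f((1-\lambda)x+\lambda y)\ge M_\alpha^\lambda(f(x),f(y))$ for all $x,y$ with $f(x)f(y)>0$ and all $\lambda\in[0,1]$.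 The Firey $L^p$-combination of convex bodies $A,B$ is $$(1-\lambda)\cdot A\oplus_p\lambda\cdot B=\{x\in\mathbb{R}^n : \langle x,u\rangle\le M_p^\lambda(h_A(u),h_B(u)) \text{ for all } u\in S^{n-1}\}.$$ **Corollary.** Let $p\in[0,1]$ and $\alpha\in[-\frac pn,+\infty]$. Let $\mu$ be an unconditional measure on $\mathbb{R}^n$ that has an $\alpha$-concave density with respect to the Lebesgue measure. Then for all unconditional convex bodies $A,B$ in $\mathbb{R}^n$ and every $\lambda\in[0,1]$, $$\mu\big((1-\lambda)\cdot A\oplus_p\lambda\cdot B\big)\ \ge\ M_\gamma^\lambda\big(\mu(A),\mu(B)\big),\qquad \gamma=\Big(\frac np+\frac1\alpha\Big)^{-1},$$ where $\gamma$ is understood as its limit value in the degenerate cases: $\gamma=0$ if $p=0$ or $\alpha=0$; $\gamma=\frac pn$ if $\alpha=+\infty$; and $\gamma=-\infty$ if $p>0$ and $\alpha=-\frac pn$. -/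

import Mathlib

open MeasureTheory Set
open scoped ENNReal NNReal

noncomputable section

/-- The `s`-mean `M_s^t(a, b)` with weight `t ∈ [0, 1]`, for `s ∈ [-∞, +∞]`. It takes values in
`[0, ∞]`, so that for `s < 0` the power `0 ^ s` is `∞` and the mean has its usual limit value when
one of the entries is `0`. -/
def pMean (s : EReal) (t : ℝ) (a b : ℝ≥0∞) : ℝ≥0∞ :=
  if s = ⊥ then min a b
  else if s = ⊤ then max a b
  else if s = 0 then a ^ (1 - t) * b ^ t
  else (ENNReal.ofReal (1 - t) * a ^ s.toReal + ENNReal.ofReal t * b ^ s.toReal) ^ (1 / s.toReal)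

/-- `α`-concavity of a function `f : ℝⁿ → [0, ∞)`, for `α ∈ [-∞, +∞]`. -/
def IsAlphaConcave {n : ℕ} (α : EReal) (f : EuclideanSpace ℝ (Fin n) → ℝ≥0) : Prop :=
  ∀ x y : EuclideanSpace ℝ (Fin n), 0 < f x * f y → ∀ t ∈ Icc (0 : ℝ) 1,
    pMean α t (f x : ℝ≥0∞) (f y : ℝ≥0∞) ≤ (f ((1 - t) • x + t • y) : ℝ≥0∞)

/-- The map `(x₁, …, xₙ) ↦ (ε₁ x₁, …, εₙ xₙ)` for signs `εᵢ ∈ {-1, 1}`. -/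
def signFlip {n : ℕ} (ε : Fin n → ℤˣ) (x : EuclideanSpace ℝ (Fin n)) :
    EuclideanSpace ℝ (Fin n) :=
  WithLp.toLp 2 fun i => ((ε i : ℤ) : ℝ) * x i

/-- A subset of `ℝⁿ` is unconditional if it is invariant under all changes of signs of the
coordinates. -/
def IsUnconditionalSet {n : ℕ} (A : Set (EuclideanSpace ℝ (Fin n))) : Prop :=
  ∀ (ε : Fin n → ℤˣ) (x : EuclideanSpace ℝ (Fin n)), signFlip ε x ∈ A ↔ x ∈ A

/-- A Borel measure on `ℝⁿ` is unconditional if it is invariant under all changes of signs of the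
coordinates. -/
def IsUnconditionalMeasure {n : ℕ} (μ : Measure (EuclideanSpace ℝ (Fin n))) : Prop :=
  ∀ ε : Fin n → ℤˣ, MeasurePreserving (signFlip ε) μ μ

/-- Compact convex sets with the origin in their interior. (Mathlib's `ConvexBody` does not ask for
the last condition.) -/
structure IsConvexBodyAtOrigin {n : ℕ} (A : Set (EuclideanSpace ℝ (Fin n))) : Prop where
  convex : Convex ℝ A
  isCompact : IsCompact A
  zero_mem_interior : (0 : EuclideanSpace ℝ (Fin n)) ∈ interior A

/-- The support function `h_A(u) = max_{x ∈ A} ⟨x, u⟩` (the supremum is attained when `A` is compact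
and nonempty). -/
def supportFn {n : ℕ} (A : Set (EuclideanSpace ℝ (Fin n))) (u : EuclideanSpace ℝ (Fin n)) : ℝ :=
  sSup ((fun x => inner ℝ x u) '' A)

/-- The Firey combination `(1 - t) · A ⊕_p t · B`: the points `x` with
`⟨x, u⟩ ≤ M_p^t(h_A(u), h_B(u))` for all unit vectors `u`. Since the right-hand side is nonnegative,
the inequality is written in `[0, ∞]`, with the positive part of `⟨x, u⟩` on the left. -/
def fireyComb {n : ℕ} (p : EReal) (t : ℝ) (A B : Set (EuclideanSpace ℝ (Fin n))) :
    Set (EuclideanSpace ℝ (Fin n)) :=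
  {x | ∀ u ∈ Metric.sphere (0 : EuclideanSpace ℝ (Fin n)) 1,
    ENNReal.ofReal (inner ℝ x u) ≤
      pMean p t (ENNReal.ofReal (supportFn A u)) (ENNReal.ofReal (supportFn B u))}

/-- The exponent `γ = (n / p + 1 / α)⁻¹`, for `n ≥ 1`, `p ∈ [0, 1]` and `-p / n ≤ α ≤ +∞`, with its
limit values in the degenerate cases: it is `0` if `p = 0` or `α = 0` (`n / p` or `1 / α` is
infinite), it is `p / n` if `α = +∞`, and it is `-∞` if `p > 0` and `α = -p / n` (then
`n / p + 1 / α` vanishes, as a limit of negative numbers). -/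
def gammaExp (n : ℕ) (p : ℝ) (α : EReal) : EReal :=
  if p = 0 ∨ α = 0 then 0
  else if α = ⊤ then ((p / n : ℝ) : EReal)
  else if α = ((-(p / n) : ℝ) : EReal) then ⊥
  else (((n / p + 1 / α.toReal)⁻¹ : ℝ) : EReal)

end

/-!
By unconditionality all `2ⁿ` open orthants carry the same part of the mass of `A`, of `B` and of
their Firey combination (`measure_eq_card_mul_openOrthant`), so it suffices to compare the masses
in the positive orthant. There, let `m_p(x, y)` be the coordinatewise `p`-mean of two points.

* If `x ∈ A` and `y ∈ B`, then `m_p(x, y)` lies in the Firey combination, because `p`-means with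
  `p ≤ 1` are superadditive (`sum_pMean_mul_le`, `realMean_mem_fireyComb`).
* The density `f` may be replaced by the minimum of its compositions with sign changes, which is
  still `α`-concave. By convexity of its superlevel sets it decreases in each coordinate of the
  orthant (`unconditionalMinorant_antitone`). As `m_p(x, y)` lies coordinatewise below `(1 - t) x
  + t y`, this gives `f (m_p(x, y)) ≥ M_α(f x, f y)`.

What remains is Borell's inequality: if `h (m_p(x, y)) ≥ M_α(f x, g y)` on the orthant, then `∫ h
≥ M_γ(∫ f, ∫ g)` (`pMean_lintegral_orthant_le`). By Tonelli's theorem the variables can be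
integrated one at a time, each integration adding `1/p` to the reciprocal of the exponent. In one
variable, the substitution `x = s ^ (1/p)` (or `x = exp s` if `p = 0`) turns `m_p` into the
arithmetic mean, at the price of a Jacobian that is `p / (1 - p)`-concave (`IsLinearization`); the
inequality is then the one-dimensional Borell–Brascamp–Lieb inequality `pMean_lintegral_le_real`.
The latter follows from the inequality `|S + T| ≥ |S| + |T|` for superlevel sets of `f / sup f`
and `g / sup g`. All changes of exponent rest on Hölder's inequality for means (`MeanHolder`).

Tonelli's theorem needs measurable functions, whereas `f` is only measurable up to null sets; a
lower semicontinuous regularisation of `f` along rays (`orthantRegularization`) has the same mass.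
-/

/-! ### Power means -/

lemma ofReal_one_sub_add {t : ℝ} (ht : t ∈ Icc (0 : ℝ) 1) :
    ENNReal.ofReal (1 - t) + ENNReal.ofReal t = 1 := by
  rw [← ENNReal.ofReal_add (by linarith [ht.2]) ht.1]; simp

lemma pMean_bot (t : ℝ) (a b : ℝ≥0∞) : pMean ⊥ t a b = min a b := by simp [pMean]

lemma pMean_top (t : ℝ) (a b : ℝ≥0∞) : pMean ⊤ t a b = max a b := by simp [pMean]

lemma pMean_zero (t : ℝ) (a b : ℝ≥0∞) : pMean 0 t a b = a ^ (1 - t) * b ^ t := by simp [pMean]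

lemma pMean_coe {s : ℝ} (hs : s ≠ 0) (t : ℝ) (a b : ℝ≥0∞) :
    pMean (s : EReal) t a b =
      (ENNReal.ofReal (1 - t) * a ^ s + ENNReal.ofReal t * b ^ s) ^ (1 / s) := by
  simp [pMean, hs]

lemma pMean_one (t : ℝ) (a b : ℝ≥0∞) :
    pMean ((1 : ℝ) : EReal) t a b = ENNReal.ofReal (1 - t) * a + ENNReal.ofReal t * b := by
  rw [pMean_coe one_ne_zero]; simp

lemma pMean_neg {s : ℝ} (hs : s ≠ 0) (t : ℝ) (a b : ℝ≥0∞) :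
    pMean ((-s : ℝ) : EReal) t a b = (pMean (s : EReal) t a⁻¹ b⁻¹)⁻¹ := by
  rw [pMean_coe hs, pMean_coe (neg_ne_zero.2 hs), ENNReal.rpow_neg, ENNReal.rpow_neg,
    ← ENNReal.inv_rpow, ← ENNReal.inv_rpow, one_div_neg_eq_neg_one_div, ENNReal.rpow_neg]

/-- Facts on power means are proved for the exponents `-∞`, `+∞`, `0`, for positive reals, and by
passing to inverses for negative reals. -/
lemma exponent_cases {P : EReal → Prop} (hbot : P ⊥) (htop : P ⊤) (h0 : P 0)
    (hpos : ∀ s : ℝ, 0 < s → P (s : EReal))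
    (hneg : ∀ s : ℝ, 0 < s → P (s : EReal) → P ((-s : ℝ) : EReal)) (s : EReal) : P s := by
  induction s with
  | bot => exact hbot
  | top => exact htop
  | coe s =>
    rcases lt_trichotomy s 0 with h | h | h
    · have := hneg (-s) (by linarith) (hpos _ (by linarith))
      rwa [neg_neg] at this
    · rw [h]; exact h0
    · exact hpos s h

lemma pMean_mono {t : ℝ} (ht : t ∈ Icc (0 : ℝ) 1) (s : EReal) :
    ∀ {a b a' b' : ℝ≥0∞}, a ≤ a' → b ≤ b' → pMean s t a b ≤ pMean s t a' b' := by
  have ht' : 0 ≤ 1 - t := by linarith [ht.2]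
  induction s using exponent_cases
  · intro a b a' b' ha hb
    simpa only [pMean_bot] using min_le_min ha hb
  · intro a b a' b' ha hb
    simpa only [pMean_top] using max_le_max ha hb
  · intro a b a' b' ha hb
    simp only [pMean_zero]
    exact mul_le_mul' (ENNReal.rpow_le_rpow ha ht') (ENNReal.rpow_le_rpow hb ht.1)
  · rename_i s hs
    intro a b a' b' ha hb
    simp only [pMean_coe hs.ne']
    gcongr
  · rename_i s hs ih
    intro a b a' b' ha hb
    simp only [pMean_neg hs.ne']
    exact ENNReal.inv_le_inv.2 (ih (ENNReal.inv_le_inv.2 ha) (ENNReal.inv_le_inv.2 hb))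

lemma pMean_self {t : ℝ} (ht : t ∈ Icc (0 : ℝ) 1) (s : EReal) :
    ∀ a : ℝ≥0∞, pMean s t a a = a := by
  have ht' : 0 ≤ 1 - t := by linarith [ht.2]
  induction s using exponent_cases
  · simp [pMean_bot]
  · simp [pMean_top]
  · intro a
    rw [pMean_zero, ← ENNReal.rpow_add_of_nonneg _ _ ht' ht.1]; simp
  · rename_i s hs
    intro a
    rw [pMean_coe hs.ne', ← add_mul, ofReal_one_sub_add ht, one_mul, ← ENNReal.rpow_mul,
      mul_one_div_cancel hs.ne', ENNReal.rpow_one]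
  · rename_i s hs ih
    intro a
    rw [pMean_neg hs.ne', ih, inv_inv]

lemma min_le_pMean {t : ℝ} (ht : t ∈ Icc (0 : ℝ) 1) (s : EReal) (a b : ℝ≥0∞) :
    min a b ≤ pMean s t a b := by
  rw [← pMean_self ht s (min a b)]
  exact pMean_mono ht s (min_le_left _ _) (min_le_right _ _)

lemma pMean_le_max {t : ℝ} (ht : t ∈ Icc (0 : ℝ) 1) (s : EReal) (a b : ℝ≥0∞) :
    pMean s t a b ≤ max a b := by
  rw [← pMean_self ht s (max a b)]
  exact pMean_mono ht s (le_max_left _ _) (le_max_right _ _)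

lemma pMean_ne_zero {t : ℝ} (ht : t ∈ Icc (0 : ℝ) 1) (s : EReal) {a b : ℝ≥0∞} (ha : a ≠ 0)
    (hb : b ≠ 0) : pMean s t a b ≠ 0 :=
  ((lt_min ha.bot_lt hb.bot_lt).trans_le (min_le_pMean ht s a b)).ne'

lemma pMean_ne_top {t : ℝ} (ht : t ∈ Icc (0 : ℝ) 1) (s : EReal) {a b : ℝ≥0∞} (ha : a ≠ ⊤)
    (hb : b ≠ ⊤) : pMean s t a b ≠ ⊤ :=
  ((pMean_le_max ht s a b).trans_lt (max_lt ha.lt_top hb.lt_top)).ne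

lemma pMean_mul_left {t : ℝ} (ht : t ∈ Icc (0 : ℝ) 1) (s : EReal) :
    ∀ {c : ℝ≥0∞}, c ≠ 0 → c ≠ ⊤ → ∀ a b : ℝ≥0∞,
      pMean s t (c * a) (c * b) = c * pMean s t a b := by
  have ht' : 0 ≤ 1 - t := by linarith [ht.2]
  induction s using exponent_cases
  · intro c _ _ a b
    simp only [pMean_bot]
    exact ((mul_right_mono (a := c)).map_min).symm
  · intro c _ _ a b
    simp only [pMean_top]
    exact ((mul_right_mono (a := c)).map_max).symm
  · intro c h0 h1 a b
    simp only [pMean_zero]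
    rw [ENNReal.mul_rpow_of_nonneg _ _ ht', ENNReal.mul_rpow_of_nonneg _ _ ht.1,
      mul_mul_mul_comm, ← ENNReal.rpow_add _ _ h0 h1]
    simp
  · rename_i s hs
    intro c h0 h1 a b
    simp only [pMean_coe hs.ne']
    rw [ENNReal.mul_rpow_of_nonneg _ _ hs.le, ENNReal.mul_rpow_of_nonneg _ _ hs.le,
      mul_left_comm, mul_left_comm _ (c ^ s), ← mul_add,
      ENNReal.mul_rpow_of_nonneg _ _ (by positivity),
      ← ENNReal.rpow_mul, mul_one_div_cancel hs.ne', ENNReal.rpow_one]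
  · rename_i s hs ih
    intro c h0 h1 a b
    simp only [pMean_neg hs.ne']
    rw [ENNReal.mul_inv (.inl h0) (.inl h1), ENNReal.mul_inv (.inl h0) (.inl h1),
      ih (ENNReal.inv_ne_zero.2 h1) (ENNReal.inv_ne_top.2 h0),
      ENNReal.mul_inv (.inl (ENNReal.inv_ne_zero.2 h1)) (.inl (ENNReal.inv_ne_top.2 h0)), inv_inv]

lemma pMean_zero_le {t : ℝ} (ht : t ∈ Icc (0 : ℝ) 1) {s : EReal} (hs : 0 ≤ s) {a b : ℝ≥0∞}
    (ha : a ≠ ⊤) (hb : b ≠ ⊤) : pMean 0 t a b ≤ pMean s t a b := by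
  have ht' : 0 ≤ 1 - t := by linarith [ht.2]
  induction s with
  | bot => simp at hs
  | top => rw [pMean_top]; exact pMean_le_max ht 0 a b
  | coe s =>
    rcases (EReal.coe_nonneg.1 hs).eq_or_lt with h | h
    · rw [← h]; rfl
    lift a to ℝ≥0 using ha
    lift b to ℝ≥0 using hb
    rw [pMean_coe h.ne', pMean_zero, one_div, ENNReal.le_rpow_inv_iff h,
      ENNReal.mul_rpow_of_nonneg _ _ h.le, ← ENNReal.rpow_mul, ← ENNReal.rpow_mul,
      mul_comm _ s, mul_comm _ s, ENNReal.rpow_mul, ENNReal.rpow_mul,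
      ← ENNReal.coe_rpow_of_nonneg _ h.le, ← ENNReal.coe_rpow_of_nonneg _ h.le,
      ← ENNReal.coe_rpow_of_nonneg _ ht', ← ENNReal.coe_rpow_of_nonneg _ ht.1]
    have := NNReal.geom_mean_le_arith_mean2_weighted (Real.toNNReal (1 - t)) (Real.toNNReal t)
      (a ^ s) (b ^ s) (by rw [← Real.toNNReal_add ht' ht.1]; simp)
    rw [Real.coe_toNNReal _ ht', Real.coe_toNNReal _ ht.1] at this
    simp only [ENNReal.ofReal]
    exact_mod_cast this

/-- Hölder's inequality `M_δ(ac, bd) ≤ M_α(a, b) M_β(c, d)` for means with the exponents `α`, `β`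
and `δ`, on positive finite entries; it holds if `1/δ = 1/α + 1/β` and `α + β ≥ 0`. -/
def MeanHolder (t : ℝ) (α β δ : EReal) : Prop :=
  ∀ ⦃a b c d : ℝ≥0∞⦄, a ≠ 0 → b ≠ 0 → c ≠ 0 → d ≠ 0 → a ≠ ⊤ → b ≠ ⊤ → c ≠ ⊤ → d ≠ ⊤ →
    pMean δ t (a * c) (b * d) ≤ pMean α t a b * pMean β t c d

namespace MeanHolder

variable {t : ℝ} {α β δ : EReal}

lemma comm (h : MeanHolder t α β δ) : MeanHolder t β α δ := by
  intro a b c d ha hb hc hd ha' hb' hc' hd'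
  rw [mul_comm a, mul_comm b, mul_comm (pMean _ _ _ _)]
  exact h hc hd ha hb hc' hd' ha' hb'

lemma right_top (ht : t ∈ Icc (0 : ℝ) 1) (α : EReal) : MeanHolder t α ⊤ α := by
  intro a b c d _ _ hc hd _ _ hc' hd'
  rw [pMean_top, mul_comm (pMean _ _ _ _), ← pMean_mul_left ht α
    (lt_max_of_lt_left hc.bot_lt).ne' (max_lt hc'.lt_top hd'.lt_top).ne, mul_comm a, mul_comm b]
  exact pMean_mono ht α (mul_le_mul_left (le_max_left _ _) _) (mul_le_mul_left (le_max_right _ _) _)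

lemma zero (ht : t ∈ Icc (0 : ℝ) 1) (hα : 0 ≤ α) (hβ : 0 ≤ β) : MeanHolder t α β 0 := by
  intro a b c d ha hb hc hd ha' hb' hc' hd'
  refine le_trans (le_of_eq ?_) (mul_le_mul' (pMean_zero_le ht hα ha' hb')
    (pMean_zero_le ht hβ hc' hd'))
  simp only [pMean_zero]
  rw [ENNReal.mul_rpow_of_nonneg _ _ (by linarith [ht.2]), ENNReal.mul_rpow_of_nonneg _ _ ht.1,
    mul_mul_mul_comm]

lemma geom_mean_superadditive {u v : ℝ} (hu : 0 < u) (hv : 0 < v) (huv : u + v = 1)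
    (a b c d : ℝ≥0∞) : a ^ u * c ^ v + b ^ u * d ^ v ≤ (a + b) ^ u * (c + d) ^ v := by
  have hpq : (1 / u).HolderConjugate (1 / v) :=
    Real.holderConjugate_one_div hu hv huv
  have := ENNReal.inner_le_Lp_mul_Lq Finset.univ ![a ^ u, b ^ u] ![c ^ v, d ^ v] hpq
  simpa [Fin.sum_univ_two, ← ENNReal.rpow_mul, hu.ne', hv.ne'] using this

/-- Hölder's inequality for positive exponents, written through their reciprocals. -/
lemma pos {x y : ℝ} (hx : 0 < x) (hy : 0 < y) :
    MeanHolder t ((x⁻¹ : ℝ) : EReal) ((y⁻¹ : ℝ) : EReal) (((x + y)⁻¹ : ℝ) : EReal) := by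
  intro a b c d _ _ _ _ _ _ _ _
  have hxy : 0 < x + y := by positivity
  rw [pMean_coe (inv_pos.2 hx).ne', pMean_coe (inv_pos.2 hy).ne', pMean_coe (inv_pos.2 hxy).ne']
  simp only [one_div, inv_inv]
  have key := geom_mean_superadditive (u := x / (x + y)) (v := y / (x + y)) (by positivity)
    (by positivity) (by field_simp)
    (ENNReal.ofReal (1 - t) * a ^ x⁻¹) (ENNReal.ofReal t * b ^ x⁻¹)
    (ENNReal.ofReal (1 - t) * c ^ y⁻¹) (ENNReal.ofReal t * d ^ y⁻¹)
  have e1 : x⁻¹ * (x / (x + y)) = (x + y)⁻¹ := by field_simp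
  have e2 : y⁻¹ * (y / (x + y)) = (x + y)⁻¹ := by field_simp
  have term (w a c : ℝ≥0∞) : w * (a * c) ^ (x + y)⁻¹ =
      (w * a ^ x⁻¹) ^ (x / (x + y)) * (w * c ^ y⁻¹) ^ (y / (x + y)) := by
    rw [ENNReal.mul_rpow_of_nonneg _ _ (by positivity),
      ENNReal.mul_rpow_of_nonneg _ _ (by positivity),
      ENNReal.mul_rpow_of_nonneg _ _ (by positivity), mul_mul_mul_comm,
      ← ENNReal.rpow_add_of_nonneg _ _ (by positivity) (by positivity), ← ENNReal.rpow_mul,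
      ← ENNReal.rpow_mul]
    rw [← add_div, div_self hxy.ne', ENNReal.rpow_one, e1, e2]
  rw [term, term]
  refine (ENNReal.rpow_le_rpow key hxy.le).trans (le_of_eq ?_)
  rw [ENNReal.mul_rpow_of_nonneg _ _ hxy.le, ← ENNReal.rpow_mul, ← ENNReal.rpow_mul,
    div_mul_cancel₀ _ hxy.ne', div_mul_cancel₀ _ hxy.ne']

lemma neg (ht : t ∈ Icc (0 : ℝ) 1) {x y : ℝ} (hy : 0 < y) (hxy : x + y < 0) :
    MeanHolder t ((x⁻¹ : ℝ) : EReal) ((y⁻¹ : ℝ) : EReal) (((x + y)⁻¹ : ℝ) : EReal) := by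
  intro a b c d ha hb hc hd ha' hb' hc' hd'
  have hs : (-x)⁻¹ ≠ 0 := (inv_pos.2 (by linarith)).ne'
  have hr : (-(x + y))⁻¹ ≠ 0 := (inv_pos.2 (by linarith)).ne'
  have e1 : x⁻¹ = -(-x)⁻¹ := by rw [inv_neg, neg_neg]
  have e2 : (x + y)⁻¹ = -(-(x + y))⁻¹ := by rw [inv_neg, neg_neg]
  rw [e1, e2, pMean_neg hs, pMean_neg hr]
  have key := pos (t := t) (x := -(x + y)) (y := y) (by linarith) hy
    (a := (a * c)⁻¹) (b := (b * d)⁻¹) (c := c) (d := d)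
    (by simp [ENNReal.mul_eq_top, *]) (by simp [ENNReal.mul_eq_top, *]) hc hd
    (by simp [*]) (by simp [*]) hc' hd'
  rw [show -(x + y) + y = -x by ring] at key
  have cancel {a c : ℝ≥0∞} (ha : a ≠ 0) (ha' : a ≠ ⊤) (hc : c ≠ 0) (hc' : c ≠ ⊤) :
      (a * c)⁻¹ * c = a⁻¹ := by
    rw [ENNReal.mul_inv (.inl ha) (.inl ha'), mul_assoc, ENNReal.inv_mul_cancel hc hc', mul_one]
  rw [cancel ha ha' hc hc', cancel hb hb' hd hd'] at key
  set M := pMean (((-x)⁻¹ : ℝ) : EReal) t a⁻¹ b⁻¹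
  have hM0 : M ≠ 0 := pMean_ne_zero ht _ (by simp [*]) (by simp [*])
  have hM1 : M ≠ ⊤ := pMean_ne_top ht _ (by simp [*]) (by simp [*])
  rw [ENNReal.inv_le_iff_inv_le, ENNReal.mul_inv (by simp [hM1]) (by simp [hM0]), inv_inv]
  rw [← div_eq_mul_inv]
  exact ENNReal.div_le_of_le_mul key

lemma bot (ht : t ∈ Icc (0 : ℝ) 1) {s : ℝ} (hs : 0 < s) :
    MeanHolder t ((-s : ℝ) : EReal) (s : EReal) ⊥ := by
  intro a b c d ha hb hc hd ha' hb' hc' hd'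
  rw [pMean_neg hs.ne', pMean_bot]
  have key := (right_top ht s) (a := c) (b := d) (c := (a * c)⁻¹) (d := (b * d)⁻¹) hc hd
    (by simp [ENNReal.mul_eq_top, *]) (by simp [ENNReal.mul_eq_top, *]) hc' hd'
    (by simp [*]) (by simp [*])
  have cancel {a c : ℝ≥0∞} (ha : a ≠ 0) (ha' : a ≠ ⊤) (hc : c ≠ 0) (hc' : c ≠ ⊤) :
      c * (a * c)⁻¹ = a⁻¹ := by
    rw [ENNReal.mul_inv (.inl ha) (.inl ha'), mul_comm, mul_assoc, ENNReal.inv_mul_cancel hc hc',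
      mul_one]
  rw [cancel ha ha' hc hc', cancel hb hb' hd hd', pMean_top] at key
  set M := pMean (s : EReal) t a⁻¹ b⁻¹
  have hM0 : M ≠ 0 := pMean_ne_zero ht _ (by simp [*]) (by simp [*])
  have hM1 : M ≠ ⊤ := pMean_ne_top ht _ (by simp [*]) (by simp [*])
  have e : max (a * c)⁻¹ (b * d)⁻¹ = (min (a * c) (b * d))⁻¹ := by
    rcases le_total (a * c) (b * d) with h | h
    · rw [min_eq_left h, max_eq_left (ENNReal.inv_le_inv.2 h)]
    · rw [min_eq_right h, max_eq_right (ENNReal.inv_le_inv.2 h)]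
  rw [e, ← div_eq_mul_inv] at key
  rw [mul_comm M⁻¹, ← div_eq_mul_inv, ENNReal.le_div_iff_mul_le (.inl hM0) (.inl hM1), mul_comm]
  exact ENNReal.mul_le_of_le_div key

/-- Hölder's inequality for two real exponents, written through their reciprocals. -/
lemma of_reciprocals (ht : t ∈ Icc (0 : ℝ) 1) {x y : ℝ} (hy : 0 < y) (hx : 0 < x ∨ x + y < 0) :
    MeanHolder t ((x⁻¹ : ℝ) : EReal) ((y⁻¹ : ℝ) : EReal) (((x + y)⁻¹ : ℝ) : EReal) :=
  hx.elim (fun h => pos h hy) fun h => neg ht hy h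

end MeanHolder

/-! ### The Borell–Brascamp–Lieb inequality on the line -/

open scoped Pointwise in
lemma volume_add_le_of_isCompact {K L : Set ℝ} (hK : IsCompact K) (hL : IsCompact L)
    (hK0 : K.Nonempty) (hL0 : L.Nonempty) : volume K + volume L ≤ volume (K + L) := by
  obtain ⟨k, hk, hkmax⟩ := hK.exists_isGreatest hK0
  obtain ⟨l, hl, hlmin⟩ := hL.exists_isLeast hL0
  -- The translates `K + l` and `k + L` meet only in the point `k + l`.
  have hsub : (fun x => x + l) '' K ∪ (fun x => k + x) '' L ⊆ K + L := by
    rintro _ (⟨x, hx, rfl⟩ | ⟨x, hx, rfl⟩)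
    · exact add_mem_add hx hl
    · exact add_mem_add hk hx
  have hdisj : AEDisjoint volume ((fun x => x + l) '' K) ((fun x => k + x) '' L) := by
    refine measure_mono_null (t := {k + l}) ?_ (by simp)
    rintro _ ⟨⟨x, hx, rfl⟩, ⟨y, hy, hxy⟩⟩
    have h1 := hkmax hx
    have h2 := hlmin hy
    simp only [mem_singleton_iff] at *
    linarith
  have hLm : NullMeasurableSet ((fun x => k + x) '' L) volume :=
    (hL.image (by fun_prop)).measurableSet.nullMeasurableSet
  calc volume K + volume L
      = volume ((fun x => x + l) '' K) + volume ((fun x => k + x) '' L) := by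
        simp [image_add_right, image_add_left]
    _ = volume ((fun x => x + l) '' K ∪ (fun x => k + x) '' L) :=
        (measure_union₀ hLm hdisj).symm
    _ ≤ volume (K + L) := measure_mono hsub

open scoped Pointwise in
/-- The Brunn–Minkowski inequality on the line. -/
lemma volume_add_le {S T W : Set ℝ} (hS : MeasurableSet S) (hT : MeasurableSet T)
    (hS0 : S.Nonempty) (hT0 : T.Nonempty) (hW : ∀ x ∈ S, ∀ y ∈ T, x + y ∈ W) :
    volume S + volume T ≤ volume W := by
  obtain ⟨s, hs⟩ := hS0
  obtain ⟨u, hu⟩ := hT0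
  have key {K L : Set ℝ} (hKS : K ⊆ S) (hK : IsCompact K) (hLT : L ⊆ T) (hL : IsCompact L) :
      volume K + volume L ≤ volume W := by
    calc volume K + volume L ≤ volume (insert s K) + volume (insert u L) := by
          gcongr <;> exact subset_insert _ _
      _ ≤ volume (insert s K + insert u L) :=
          volume_add_le_of_isCompact (hK.insert s) (hL.insert u) (insert_nonempty _ _)
            (insert_nonempty _ _)
      _ ≤ volume W := by
          refine measure_mono ?_
          rintro _ ⟨x, hx, y, hy, rfl⟩
          exact hW x (insert_subset hs hKS hx) y (insert_subset hu hLT hy)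
  rw [hS.measure_eq_iSup_isCompact volume, hT.measure_eq_iSup_isCompact volume]
  simp only [iSup_and']
  exact ENNReal.biSup_add_biSup_le' ⟨∅, empty_subset _, isCompact_empty⟩
    ⟨∅, empty_subset _, isCompact_empty⟩ fun K hK L hL => key hK.1 hK.2 hL.1 hL.2

open scoped Pointwise in
lemma volume_combination_le {t : ℝ} (ht : t ∈ Icc (0 : ℝ) 1) {S T W : Set ℝ}
    (hS : MeasurableSet S) (hT : MeasurableSet T) (hS0 : S.Nonempty) (hT0 : T.Nonempty)
    (hW : ∀ x ∈ S, ∀ y ∈ T, (1 - t) * x + t * y ∈ W) :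
    ENNReal.ofReal (1 - t) * volume S + ENNReal.ofReal t * volume T ≤ volume W := by
  have h := volume_add_le (S := (1 - t) • S) (T := t • T) (W := W) (hS.const_smul₀ _)
    (hT.const_smul₀ _) hS0.smul_set hT0.smul_set (by
      rintro _ ⟨x, hx, rfl⟩ _ ⟨y, hy, rfl⟩
      exact hW x hx y hy)
  simpa [Measure.addHaar_smul, abs_of_nonneg ht.1, abs_of_nonneg (sub_nonneg.2 ht.2)] using h

/-- The layer-cake formula for a function with values in `[0, 1]`. -/
lemma lintegral_eq_lintegral_meas_lt_unit {F : ℝ → ℝ≥0∞} (hF : Measurable F) (hF1 : ∀ x, F x ≤ 1) :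
    ∫⁻ x, F x = ∫⁻ r in Ioo (0 : ℝ) 1, volume {x | ENNReal.ofReal r < F x} := by
  have h := lintegral_eq_lintegral_meas_lt (volume : Measure ℝ) (f := fun x => (F x).toReal)
    (ae_of_all _ fun _ => ENNReal.toReal_nonneg) hF.ennreal_toReal.aemeasurable
  have hne (x) : F x ≠ ⊤ := ((hF1 x).trans_lt ENNReal.one_lt_top).ne
  simp only [ENNReal.ofReal_toReal (hne _)] at h
  rw [h, ← Ioo_union_Ici_eq_Ioi zero_lt_one, lintegral_union measurableSet_Ici
    (by rw [Set.disjoint_left]; intro x hx hx'; exact absurd hx.2 (not_lt.2 hx'))]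
  have h0 : ∫⁻ r in Ici (1 : ℝ), volume {x | r < (F x).toReal} = 0 := by
    rw [setLIntegral_congr_fun (g := fun _ => 0) measurableSet_Ici]
    · simp
    · intro r hr
      have : {x | r < (F x).toReal} = ∅ := by
        ext x
        simp only [mem_ofPred_eq, mem_empty_iff_false, iff_false, not_lt]
        exact (ENNReal.toReal_le_of_le_ofReal zero_le_one (by simpa using hF1 x)).trans hr
      simp [this]
  rw [h0, add_zero]
  refine setLIntegral_congr_fun measurableSet_Ioo fun r hr => ?_
  simp only [ENNReal.ofReal_lt_iff_lt_toReal hr.1.le (hne _)]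

/-- The arithmetic-mean form of the inequality, for functions with supremum `1`: compare the
superlevel sets of the three functions at each height. -/
lemma lintegral_combination_le {t : ℝ} (ht : t ∈ Icc (0 : ℝ) 1) {F G H : ℝ → ℝ≥0∞}
    (hF : Measurable F) (hG : Measurable G) (hH : Measurable H)
    (hF1 : ⨆ x, F x = 1) (hG1 : ⨆ x, G x = 1)
    (hFGH : ∀ x y, F x ≠ 0 → G y ≠ 0 → min (F x) (G y) ≤ H ((1 - t) * x + t * y)) :
    ENNReal.ofReal (1 - t) * (∫⁻ x, F x) + ENNReal.ofReal t * (∫⁻ x, G x) ≤ ∫⁻ x, H x := by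
  have hle {F : ℝ → ℝ≥0∞} (hF1 : ⨆ x, F x = 1) (x) : F x ≤ 1 := hF1 ▸ le_iSup F x
  calc _ ≤ ∫⁻ x, min (H x) 1 := ?_
    _ ≤ _ := lintegral_mono fun x => min_le_left _ _
  rw [lintegral_eq_lintegral_meas_lt_unit hF (hle hF1),
    lintegral_eq_lintegral_meas_lt_unit hG (hle hG1),
    lintegral_eq_lintegral_meas_lt_unit (hH.min measurable_const) (fun x => min_le_right _ _),
    ← lintegral_const_mul' _ _ ENNReal.ofReal_ne_top,
    ← lintegral_const_mul' _ _ ENNReal.ofReal_ne_top]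
  refine (le_lintegral_add _ _).trans (setLIntegral_mono' measurableSet_Ioo fun r hr => ?_)
  have hr1 : ENNReal.ofReal r < 1 := by simpa using hr.2
  have hne {F : ℝ → ℝ≥0∞} (hF1 : ⨆ x, F x = 1) : {x | ENNReal.ofReal r < F x}.Nonempty :=
    have ⟨x, hx⟩ := lt_iSup_iff.1 (hF1 ▸ hr1)
    ⟨x, hx⟩
  refine volume_combination_le ht (measurableSet_lt measurable_const hF)
    (measurableSet_lt measurable_const hG) (hne hF1) (hne hG1) fun x hx y hy => ?_
  exact lt_min ((lt_min hx hy).trans_le (hFGH x y (pos_of_gt hx).ne' (pos_of_gt hy).ne')) hr1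

/-- The Borell–Brascamp–Lieb inequality on the line, for bounded functions. Dividing `F` and `G` by
their suprema `a` and `b` reduces it to the arithmetic-mean form, which gives
`∫ H ≥ M_δ(a, b) M_1(∫ F / a, ∫ G / b)`; Hölder's inequality for means does the rest. -/
lemma pMean_lintegral_le_real {t : ℝ} (ht : t ∈ Icc (0 : ℝ) 1) {δ γ : EReal}
    (hγ : MeanHolder t δ ((1 : ℝ) : EReal) γ) {F G H : ℝ → ℝ≥0∞}
    (hF : Measurable F) (hG : Measurable G) (hH : Measurable H)
    (hFb : ⨆ x, F x ≠ ⊤) (hGb : ⨆ x, G x ≠ ⊤)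
    (hF0 : ∫⁻ x, F x ≠ 0) (hG0 : ∫⁻ x, G x ≠ 0)
    (hFi : ∫⁻ x, F x ≠ ⊤) (hGi : ∫⁻ x, G x ≠ ⊤)
    (hFGH : ∀ x y, F x ≠ 0 → G y ≠ 0 → pMean δ t (F x) (G y) ≤ H ((1 - t) * x + t * y)) :
    pMean γ t (∫⁻ x, F x) (∫⁻ x, G x) ≤ ∫⁻ x, H x := by
  have hsup {F : ℝ → ℝ≥0∞} (hF0 : ∫⁻ x, F x ≠ 0) : ⨆ x, F x ≠ 0 := by
    contrapose! hF0
    simp [ENNReal.iSup_eq_zero.1 hF0]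
  have ha0 := hsup hF0
  have hb0 := hsup hG0
  set a := ⨆ x, F x with ha
  set b := ⨆ x, G x with hb
  set m := pMean δ t a b with hm
  have hm0 : m ≠ 0 := pMean_ne_zero ht _ ha0 hb0
  have hm1 : m ≠ ⊤ := pMean_ne_top ht _ hFb hGb
  have hnorm : ENNReal.ofReal (1 - t) * (∫⁻ x, a⁻¹ * F x) + ENNReal.ofReal t * (∫⁻ x, b⁻¹ * G x)
      ≤ ∫⁻ x, m⁻¹ * H x := by
    refine lintegral_combination_le ht (hF.const_mul _) (hG.const_mul _) (hH.const_mul _)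
      (by rw [← ENNReal.mul_iSup, ← ha, ENNReal.inv_mul_cancel ha0 hFb])
      (by rw [← ENNReal.mul_iSup, ← hb, ENNReal.inv_mul_cancel hb0 hGb]) fun x y hx hy => ?_
    set c := min (a⁻¹ * F x) (b⁻¹ * G y) with hc
    have hc0 : c ≠ 0 := (lt_min hx.bot_lt hy.bot_lt).ne'
    have hFa : a⁻¹ * F x ≤ 1 := by
      rw [← ENNReal.inv_mul_cancel ha0 hFb]
      gcongr
      exact le_iSup F x
    have hc1 : c ≠ ⊤ := (((min_le_left _ _).trans hFa).trans_lt ENNReal.one_lt_top).ne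
    have h1 : c * a ≤ F x := by
      calc c * a ≤ a⁻¹ * F x * a := by gcongr; exact min_le_left _ _
        _ = F x := by rw [mul_right_comm, ENNReal.inv_mul_cancel ha0 hFb, one_mul]
    have h2 : c * b ≤ G y := by
      calc c * b ≤ b⁻¹ * G y * b := by gcongr; exact min_le_right _ _
        _ = G y := by rw [mul_right_comm, ENNReal.inv_mul_cancel hb0 hGb, one_mul]
    have h3 := (pMean_mono ht δ h1 h2).trans
      (hFGH x y (right_ne_zero_of_mul hx) (right_ne_zero_of_mul hy))
    rw [pMean_mul_left ht δ hc0 hc1, ← hm] at h3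
    rwa [mul_comm, ← div_eq_mul_inv, ENNReal.le_div_iff_mul_le (.inl hm0) (.inl hm1)]
  rw [lintegral_const_mul _ hF, lintegral_const_mul _ hG, lintegral_const_mul _ hH,
    ← pMean_one] at hnorm
  have ai0 := ENNReal.inv_ne_zero.2 hFb
  have bi0 := ENNReal.inv_ne_zero.2 hGb
  have ait := ENNReal.inv_ne_top.2 ha0
  have bit := ENNReal.inv_ne_top.2 hb0
  have hhold := hγ ha0 hb0 (mul_ne_zero ai0 hF0) (mul_ne_zero bi0 hG0) hFb hGb
    (ENNReal.mul_ne_top ait hFi) (ENNReal.mul_ne_top bit hGi)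
  rw [ENNReal.mul_inv_cancel_left ha0 hFb, ENNReal.mul_inv_cancel_left hb0 hGb] at hhold
  calc _ ≤ _ := hhold
    _ ≤ m * (m⁻¹ * ∫⁻ x, H x) := by gcongr
    _ = _ := ENNReal.mul_inv_cancel_left hm0 hm1

noncomputable section

/-! ### The inequality for power means of points of the open orthant -/

/-- The mean `M_p^t(x, y)` of two real numbers `x, y ≥ 0`, as a real number. -/
def realMean (p t x y : ℝ) : ℝ :=
  (pMean (p : EReal) t (ENNReal.ofReal x) (ENNReal.ofReal y)).toReal

lemma ofReal_realMean {p t : ℝ} (ht : t ∈ Icc (0 : ℝ) 1) (x y : ℝ) :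
    ENNReal.ofReal (realMean p t x y) =
      pMean (p : EReal) t (ENNReal.ofReal x) (ENNReal.ofReal y) :=
  ENNReal.ofReal_toReal (pMean_ne_top ht _ ENNReal.ofReal_ne_top ENNReal.ofReal_ne_top)

lemma realMean_pos {p t : ℝ} (ht : t ∈ Icc (0 : ℝ) 1) {x y : ℝ} (hx : 0 < x) (hy : 0 < y) :
    0 < realMean p t x y :=
  ENNReal.toReal_pos (pMean_ne_zero ht _ (by simpa) (by simpa))
    (pMean_ne_top ht _ ENNReal.ofReal_ne_top ENNReal.ofReal_ne_top)

lemma combination_pos {t : ℝ} (ht : t ∈ Icc (0 : ℝ) 1) {x y : ℝ} (hx : 0 < x) (hy : 0 < y) :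
    0 < (1 - t) * x + t * y := by
  rcases ht.1.eq_or_lt with h | h
  · simp [← h, hx]
  · have := sub_nonneg.2 ht.2
    positivity

lemma pMean_ofReal_rpow {r t : ℝ} (hr : r ≠ 0) (ht : t ∈ Icc (0 : ℝ) 1) {x y : ℝ} (hx : 0 < x)
    (hy : 0 < y) :
    pMean (r : EReal) t (ENNReal.ofReal (x ^ r⁻¹)) (ENNReal.ofReal (y ^ r⁻¹)) =
      ENNReal.ofReal (((1 - t) * x + t * y) ^ r⁻¹) := by
  have ht' : 0 ≤ 1 - t := by linarith [ht.2]
  have hxy := combination_pos ht hx hy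
  rw [pMean_coe hr, ENNReal.ofReal_rpow_of_pos (by positivity),
    ENNReal.ofReal_rpow_of_pos (by positivity), Real.rpow_inv_rpow hx.le hr,
    Real.rpow_inv_rpow hy.le hr, ← ENNReal.ofReal_mul ht', ← ENNReal.ofReal_mul ht.1,
    ← ENNReal.ofReal_add (mul_nonneg ht' hx.le) (mul_nonneg ht.1 hy.le),
    ENNReal.ofReal_rpow_of_pos hxy, one_div]

/-- The Jacobian of the substitution that turns `M_p` into the arithmetic mean is
`p / (1 - p)`-concave. This exponent is `+∞` for `p = 1`, where the substitution is the identity. -/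
def jacobianExp (p : ℝ) : EReal := if p = 1 then ⊤ else ((p / (1 - p) : ℝ) : EReal)

/-- `T` is a bijection of `D` onto `(0, ∞)` with derivative `J > 0` that turns arithmetic means into
`p`-means; `J` is `p / (1 - p)`-concave, and bounded wherever `T` is bounded above. Such a `T` is
`s ↦ s ^ (1/p)` on `(0, ∞)` for `p > 0` and the exponential on the line for `p = 0`. -/
structure IsLinearization (p t : ℝ) (D : Set ℝ) (T J : ℝ → ℝ) : Prop where
  measurableSet : MeasurableSet D
  measurable : Measurable T
  measurable_deriv : Measurable J
  hasDerivWithinAt : ∀ s ∈ D, HasDerivWithinAt T (J s) D s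
  injOn : InjOn T D
  image_eq : T '' D = Ioi 0
  deriv_pos : ∀ s ∈ D, 0 < J s
  deriv_bounded : ∀ R, ∃ K, ∀ s ∈ D, T s < R → J s ≤ K
  combination_mem : ∀ s ∈ D, ∀ u ∈ D, (1 - t) * s + t * u ∈ D
  map_combination : ∀ s ∈ D, ∀ u ∈ D, T ((1 - t) * s + t * u) = realMean p t (T s) (T u)
  deriv_concave : ∀ s ∈ D, ∀ u ∈ D,
    pMean (jacobianExp p) t (ENNReal.ofReal (J s)) (ENNReal.ofReal (J u)) ≤
      ENNReal.ofReal (J ((1 - t) * s + t * u))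

lemma isLinearization_exp (t : ℝ) :
    IsLinearization 0 t univ Real.exp Real.exp := by
  have key (s u : ℝ) : pMean ((0 : ℝ) : EReal) t (ENNReal.ofReal (Real.exp s))
      (ENNReal.ofReal (Real.exp u)) = ENNReal.ofReal (Real.exp ((1 - t) * s + t * u)) := by
    rw [EReal.coe_zero, pMean_zero, ENNReal.ofReal_rpow_of_pos (Real.exp_pos _),
      ENNReal.ofReal_rpow_of_pos (Real.exp_pos _), ← ENNReal.ofReal_mul (by positivity),
      ← Real.exp_mul, ← Real.exp_mul, ← Real.exp_add, mul_comm s, mul_comm u]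
  refine ⟨.univ, by fun_prop, by fun_prop, fun s _ => (Real.hasDerivAt_exp s).hasDerivWithinAt,
    Real.exp_injective.injOn, by rw [image_univ, Real.range_exp], fun s _ => Real.exp_pos s,
    fun R => ⟨R, fun s _ h => h.le⟩, fun _ _ _ _ => mem_univ _, fun s _ u _ => ?_,
    fun s _ u _ => ?_⟩
  · rw [realMean, key, ENNReal.toReal_ofReal (Real.exp_pos _).le]
  · simpa [jacobianExp] using (key s u).le

lemma isLinearization_rpow {p t : ℝ} (hp : 0 < p) (hp1 : p ≤ 1) (ht : t ∈ Icc (0 : ℝ) 1) :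
    IsLinearization p t (Ioi 0) (fun s => s ^ p⁻¹) (fun s => p⁻¹ * s ^ (p⁻¹ - 1)) := by
  have hp' : 0 < p⁻¹ := inv_pos.2 hp
  have hpe : 0 ≤ p⁻¹ - 1 := sub_nonneg.2 (one_le_inv_iff₀.2 ⟨hp, hp1⟩)
  refine ⟨measurableSet_Ioi, by fun_prop, by fun_prop, fun s hs => ?_, ?_, ?_, fun s hs => ?_,
    fun R => ⟨p⁻¹ * (R ^ p) ^ (p⁻¹ - 1), fun s hs h => ?_⟩,
    fun s hs u hu => combination_pos ht hs hu,
    fun s hs u hu => ?_, fun s hs u hu => ?_⟩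
  · exact (Real.hasDerivAt_rpow_const (.inl (ne_of_gt hs))).hasDerivWithinAt
  · intro s hs u hu h
    exact (Real.rpow_left_inj (le_of_lt hs) (le_of_lt hu) hp'.ne').1 h
  · ext x
    refine ⟨?_, fun hx => ⟨x ^ p, Real.rpow_pos_of_pos hx p,
      Real.rpow_rpow_inv (le_of_lt hx) hp.ne'⟩⟩
    rintro ⟨s, hs, rfl⟩
    exact Real.rpow_pos_of_pos hs _
  · exact mul_pos hp' (Real.rpow_pos_of_pos hs _)
  · have hs0 : 0 ≤ s := le_of_lt hs
    have : s ≤ R ^ p := by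
      rw [← Real.rpow_inv_rpow hs0 hp.ne']
      exact Real.rpow_le_rpow (Real.rpow_nonneg hs0 _) h.le hp.le
    gcongr
  · rw [realMean, pMean_ofReal_rpow hp.ne' ht hs hu, ENNReal.toReal_ofReal]
    exact Real.rpow_nonneg (combination_pos ht hs hu).le _
  · have hm (s : ℝ) : ENNReal.ofReal (p⁻¹ * s ^ (p⁻¹ - 1)) =
        ENNReal.ofReal p⁻¹ * ENNReal.ofReal (s ^ (p⁻¹ - 1)) := ENNReal.ofReal_mul hp'.le
    simp only [hm]
    rw [pMean_mul_left ht _ (by simpa) ENNReal.ofReal_ne_top]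
    gcongr
    rw [jacobianExp]
    split_ifs with h1
    · simp [h1, pMean_self ht]
    · have hr : p / (1 - p) ≠ 0 := div_ne_zero hp.ne' (sub_ne_zero.2 (Ne.symm h1))
      have e : p⁻¹ - 1 = (p / (1 - p))⁻¹ := by field_simp
      rw [e, pMean_ofReal_rpow hr ht hs hu]

lemma exists_isLinearization {p t : ℝ} (hp : p ∈ Icc (0 : ℝ) 1) (ht : t ∈ Icc (0 : ℝ) 1) :
    ∃ D T J, IsLinearization p t D T J := by
  rcases hp.1.eq_or_lt with rfl | h
  · exact ⟨_, _, _, isLinearization_exp t⟩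
  · exact ⟨_, _, _, isLinearization_rpow h hp.2 ht⟩

/-- One integration over `(0, ∞)` leads from the exponent `α` to the exponent `γ`, in general the
one with `1/γ = 1/α + 1/p`: multiplication by the Jacobian of the substitution gives an intermediate
exponent `δ`, and integration over the line gives `γ`. -/
def IsMarginalExp (p t : ℝ) (α γ : EReal) : Prop :=
  ∃ δ, MeanHolder t α (jacobianExp p) δ ∧ MeanHolder t δ ((1 : ℝ) : EReal) γ

/-- `n` successive integrations over `(0, ∞)` lead from the exponent `α` to the exponent `γ`. -/
def IsIteratedMarginalExp (p t : ℝ) : ℕ → EReal → EReal → Prop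
  | 0, α, γ => γ = α
  | n + 1, α, γ => ∃ γ', IsIteratedMarginalExp p t n α γ' ∧ IsMarginalExp p t γ' γ

lemma IsLinearization.lintegral_Ioi {p t : ℝ} {D : Set ℝ} {T J : ℝ → ℝ}
    (hL : IsLinearization p t D T J) (f : ℝ → ℝ≥0∞) :
    ∫⁻ s, D.indicator (fun s => ENNReal.ofReal (J s) * f (T s)) s = ∫⁻ x in Ioi (0 : ℝ), f x := by
  rw [lintegral_indicator hL.measurableSet, ← hL.image_eq,
    lintegral_image_eq_lintegral_abs_deriv_mul hL.measurableSet hL.hasDerivWithinAt hL.injOn]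
  refine setLIntegral_congr_fun hL.measurableSet fun s hs => ?_
  simp only [abs_of_pos (hL.deriv_pos s hs)]

lemma pMean_lintegral_Ioi_le {p t : ℝ} (hp : p ∈ Icc (0 : ℝ) 1) (ht : t ∈ Icc (0 : ℝ) 1)
    {α γ : EReal} (hγ : IsMarginalExp p t α γ) {f g h : ℝ → ℝ≥0∞} (hf : Measurable f)
    (hg : Measurable g) (hh : Measurable h) {C : ℝ≥0∞} (hC : C ≠ ⊤) {R : ℝ}
    (hfC : ∀ x, f x ≤ C) (hgC : ∀ x, g x ≤ C)
    (hfR : ∀ x, f x ≠ 0 → x ∈ Ioo 0 R) (hgR : ∀ x, g x ≠ 0 → x ∈ Ioo 0 R)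
    (hf0 : ∫⁻ x, f x ≠ 0) (hg0 : ∫⁻ x, g x ≠ 0)
    (hfgh : ∀ x y, f x ≠ 0 → g y ≠ 0 → pMean α t (f x) (g y) ≤ h (realMean p t x y)) :
    pMean γ t (∫⁻ x, f x) (∫⁻ x, g x) ≤ ∫⁻ x, h x := by
  obtain ⟨D, T, J, hL⟩ := exists_isLinearization hp ht
  obtain ⟨δ, hδ, hγ⟩ := hγ
  obtain ⟨K, hK⟩ := hL.deriv_bounded R
  set S : (ℝ → ℝ≥0∞) → ℝ → ℝ≥0∞ :=
    fun f => D.indicator (fun s => ENNReal.ofReal (J s) * f (T s)) with hS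
  have hSm {f : ℝ → ℝ≥0∞} (hf : Measurable f) : Measurable (S f) :=
    ((hL.measurable_deriv.ennreal_ofReal).mul (hf.comp hL.measurable)).indicator hL.measurableSet
  have hSne {f : ℝ → ℝ≥0∞} {s} (hs : S f s ≠ 0) : s ∈ D ∧ f (T s) ≠ 0 := by
    have h1 := mem_of_indicator_ne_zero hs
    refine ⟨h1, fun h2 => hs ?_⟩
    simp [hS, h2]
  have hSval {f : ℝ → ℝ≥0∞} {s} (hs : s ∈ D) : S f s = ENNReal.ofReal (J s) * f (T s) :=
    indicator_of_mem hs _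
  have hSb {f : ℝ → ℝ≥0∞} (hfC : ∀ x, f x ≤ C) (hfR : ∀ x, f x ≠ 0 → x ∈ Ioo 0 R) :
      ⨆ s, S f s ≠ ⊤ := by
    refine ((iSup_le fun s => ?_).trans_lt
      (ENNReal.mul_lt_top (ENNReal.ofReal_lt_top (r := K)) hC.lt_top)).ne
    by_cases hs : S f s = 0
    · simp [hs]
    · obtain ⟨hD, hT⟩ := hSne hs
      rw [hSval hD]
      exact mul_le_mul' (ENNReal.ofReal_le_ofReal (hK s hD (hfR _ hT).2)) (hfC _)
  have hint {f : ℝ → ℝ≥0∞} (hfR : ∀ x, f x ≠ 0 → x ∈ Ioo 0 R) :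
      ∫⁻ s, S f s = ∫⁻ x, f x := by
    rw [hL.lintegral_Ioi, setLIntegral_eq_of_support_subset]
    exact fun x hx => (hfR x hx).1
  have hfin {f : ℝ → ℝ≥0∞} (hfC : ∀ x, f x ≤ C) (hfR : ∀ x, f x ≠ 0 → x ∈ Ioo 0 R) :
      ∫⁻ x, f x ≠ ⊤ := by
    rw [← setLIntegral_eq_of_support_subset (s := Ioo 0 R) fun x hx => hfR x hx]
    refine ((lintegral_mono fun x => hfC x).trans_lt ?_).ne
    simpa using ENNReal.mul_lt_top hC.lt_top ENNReal.ofReal_lt_top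
  have key := pMean_lintegral_le_real ht hγ (hSm hf) (hSm hg) (hSm hh) (hSb hfC hfR) (hSb hgC hgR)
    (by rwa [hint hfR]) (by rwa [hint hgR]) (by rw [hint hfR]; exact hfin hfC hfR)
    (by rw [hint hgR]; exact hfin hgC hgR) fun s u hs hu => by
      obtain ⟨hs, hfs⟩ := hSne hs
      obtain ⟨hu, hgu⟩ := hSne hu
      have hfs' := ((hfC (T s)).trans_lt hC.lt_top).ne
      have hgu' := ((hgC (T u)).trans_lt hC.lt_top).ne
      have hJs := hL.deriv_pos s hs
      have hJu := hL.deriv_pos u hu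
      rw [hSval hs, hSval hu, hSval (hL.combination_mem s hs u hu), hL.map_combination s hs u hu]
      exact (hδ.comm (by simpa) (by simpa) hfs hgu ENNReal.ofReal_ne_top ENNReal.ofReal_ne_top
        hfs' hgu').trans (mul_le_mul' (hL.deriv_concave s hs u hu) (hfgh _ _ hfs hgu))
  rw [hint hfR, hint hgR, hL.lintegral_Ioi] at key
  exact key.trans (setLIntegral_le_lintegral _ _)

lemma measurable_cons (n : ℕ) :
    Measurable fun z : ℝ × (Fin n → ℝ) => (Fin.cons z.1 z.2 : Fin (n + 1) → ℝ) := by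
  refine measurable_pi_lambda _ fun i => ?_
  refine Fin.cases ?_ (fun i => ?_) i
  · simpa using measurable_fst
  · exact (measurable_pi_apply i).comp measurable_snd

lemma lintegral_fin_succ {n : ℕ} {f : (Fin (n + 1) → ℝ) → ℝ≥0∞} (hf : Measurable f) :
    ∫⁻ x, f x = ∫⁻ a : ℝ, ∫⁻ v : Fin n → ℝ, f (Fin.cons a v) := by
  have e := (volume_preserving_piFinSuccAbove (fun _ : Fin (n + 1) => ℝ) 0).symm
  rw [← e.lintegral_comp hf, Measure.volume_eq_prod, lintegral_prod _ (by
    exact (hf.comp (MeasurableEquiv.measurable _)).aemeasurable)]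
  simp [MeasurableEquiv.piFinSuccAbove, Fin.insertNthEquiv]

/-- Borell's generalisation of the Prékopa–Leindler inequality on the open orthant: integrate one
variable after the other. -/
theorem pMean_lintegral_orthant_le {p t : ℝ} (hp : p ∈ Icc (0 : ℝ) 1) (ht : t ∈ Icc (0 : ℝ) 1)
    {α : EReal} {R : ℝ} : ∀ {n : ℕ} {γ : EReal}, IsIteratedMarginalExp p t n α γ →
    ∀ {f g h : (Fin n → ℝ) → ℝ≥0∞}, Measurable f → Measurable g → Measurable h →
    ∀ {C : ℝ≥0∞}, C ≠ ⊤ → (∀ x, f x ≤ C) → (∀ x, g x ≤ C) →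
    (∀ x, f x ≠ 0 → ∀ i, x i ∈ Ioo 0 R) → (∀ x, g x ≠ 0 → ∀ i, x i ∈ Ioo 0 R) →
    ∫⁻ x, f x ≠ 0 → ∫⁻ x, g x ≠ 0 →
    (∀ x y, f x ≠ 0 → g y ≠ 0 → pMean α t (f x) (g y) ≤ h fun i => realMean p t (x i) (y i)) →
    pMean γ t (∫⁻ x, f x) (∫⁻ x, g x) ≤ ∫⁻ x, h x := by
  intro n
  induction n with
  | zero =>
    intro γ hγ f g h hf hg hh C hC hfC hgC hfR hgR hf0 hg0 hfgh
    obtain rfl : γ = α := hγ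
    simp only [Measure.volume_pi_eq_dirac (default : Fin 0 → ℝ), lintegral_dirac] at hf0 hg0 ⊢
    convert hfgh _ _ hf0 hg0
  | succ n ih =>
    intro γ hγ f g h hf hg hh C hC hfC hgC hfR hgR hf0 hg0 hfgh
    obtain ⟨γ', hγ', hγ⟩ := hγ
    rw [lintegral_fin_succ hf] at hf0 ⊢
    rw [lintegral_fin_succ hg] at hg0 ⊢
    rw [lintegral_fin_succ hh]
    have hm {f : (Fin (n + 1) → ℝ) → ℝ≥0∞} (hf : Measurable f) :
        Measurable fun a : ℝ => ∫⁻ v : Fin n → ℝ, f (Fin.cons a v) :=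
      (hf.comp (measurable_cons n)).lintegral_prod_right'
    have hs {f : (Fin (n + 1) → ℝ) → ℝ≥0∞} (hf : Measurable f) (a : ℝ) :
        Measurable fun v : Fin n → ℝ => f (Fin.cons a v) :=
      (hf.comp (measurable_cons n)).comp measurable_prodMk_left
    have hbox {f : (Fin (n + 1) → ℝ) → ℝ≥0∞} (hfR : ∀ x, f x ≠ 0 → ∀ i, x i ∈ Ioo 0 R) (a : ℝ)
        (v : Fin n → ℝ) (hv : f (Fin.cons a v) ≠ 0) (i : Fin n) : v i ∈ Ioo 0 R := by
      simpa using hfR _ hv i.succ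
    have hb {f : (Fin (n + 1) → ℝ) → ℝ≥0∞} (hfC : ∀ x, f x ≤ C)
        (hfR : ∀ x, f x ≠ 0 → ∀ i, x i ∈ Ioo 0 R) (a : ℝ) :
        ∫⁻ v : Fin n → ℝ, f (Fin.cons a v) ≤ C * ENNReal.ofReal R ^ n := by
      rw [← setLIntegral_eq_of_support_subset (s := univ.pi fun _ => Ioo 0 R) fun v hv i _ =>
        hbox hfR a v hv i]
      refine (lintegral_mono fun v => hfC _).trans ?_
      simp [Real.volume_pi_Ioo]
    have hR {f : (Fin (n + 1) → ℝ) → ℝ≥0∞}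
        (hfR : ∀ x, f x ≠ 0 → ∀ i, x i ∈ Ioo 0 R) (a : ℝ)
        (ha : ∫⁻ v : Fin n → ℝ, f (Fin.cons a v) ≠ 0) : a ∈ Ioo 0 R := by
      contrapose! ha
      have (v : Fin n → ℝ) : f (Fin.cons a v) = 0 := by
        by_contra hv
        exact ha (by simpa using hfR _ hv 0)
      simp [this]
    refine pMean_lintegral_Ioi_le hp ht hγ (hm hf) (hm hg) (hm hh)
      (ENNReal.mul_ne_top hC (ENNReal.pow_ne_top ENNReal.ofReal_ne_top)) (hb hfC hfR) (hb hgC hgR)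
      (hR hfR) (hR hgR) hf0 hg0 fun a b ha hb => ?_
    refine ih hγ' (hs hf a) (hs hg b) (hs hh _) hC (fun v => hfC _) (fun v => hgC _)
      (hbox hfR a) (hbox hgR b) ha hb fun v w hv hw => ?_
    refine (hfgh _ _ hv hw).trans (le_of_eq ?_)
    congr 1
    ext i
    refine Fin.cases ?_ (fun i => ?_) i <;> simp

/-! ### The exponent after `n` integrations -/

lemma isMarginalExp_zero {t : ℝ} (ht : t ∈ Icc (0 : ℝ) 1) {p : ℝ} (hp : p ∈ Icc (0 : ℝ) 1)
    {α : EReal} (hα : 0 ≤ α) : IsMarginalExp p t α 0 := by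
  refine ⟨0, MeanHolder.zero ht hα ?_, MeanHolder.zero ht le_rfl (by simp)⟩
  rw [jacobianExp]
  split_ifs
  · exact le_top
  · exact EReal.coe_nonneg.2 (div_nonneg hp.1 (sub_nonneg.2 hp.2))

lemma jacobianExp_of_lt_one {p : ℝ} (hp0 : 0 < p) (hp1 : p < 1) :
    jacobianExp p = (((p⁻¹ - 1)⁻¹ : ℝ) : EReal) := by
  have := sub_pos.2 hp1
  rw [jacobianExp, if_neg hp1.ne]
  congr 1
  field_simp

/-- The finite exponents `α`, written through `x = 1/α`. -/
lemma isMarginalExp_inv {t : ℝ} (ht : t ∈ Icc (0 : ℝ) 1) {p : ℝ} (hp0 : 0 < p) (hp1 : p ≤ 1)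
    {x : ℝ} (hx : 0 < x ∨ x + p⁻¹ < 0) :
    IsMarginalExp p t ((x⁻¹ : ℝ) : EReal) (((x + p⁻¹)⁻¹ : ℝ) : EReal) := by
  rcases hp1.eq_or_lt with rfl | hp1
  · refine ⟨_, by rw [jacobianExp, if_pos rfl]; exact MeanHolder.right_top ht _, ?_⟩
    simpa using MeanHolder.of_reciprocals ht zero_lt_one (by simpa using hx)
  · have hp' : 1 < p⁻¹ := (one_lt_inv₀ hp0).2 hp1
    rw [IsMarginalExp, jacobianExp_of_lt_one hp0 hp1]
    refine ⟨_, MeanHolder.of_reciprocals ht (by linarith) (hx.imp_right fun h => by linarith), ?_⟩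
    have := MeanHolder.of_reciprocals ht (x := x + (p⁻¹ - 1)) zero_lt_one
      (hx.imp (fun h => by linarith) fun h => by linarith)
    rwa [inv_one, show x + (p⁻¹ - 1) + 1 = x + p⁻¹ by ring] at this

lemma isMarginalExp_bot {t : ℝ} (ht : t ∈ Icc (0 : ℝ) 1) {p : ℝ} (hp0 : 0 < p) (hp1 : p ≤ 1) :
    IsMarginalExp p t ((-p : ℝ) : EReal) ⊥ := by
  refine ⟨((-1 : ℝ) : EReal), ?_, MeanHolder.bot ht zero_lt_one⟩
  rcases hp1.eq_or_lt with rfl | hp1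
  · rw [jacobianExp, if_pos rfl]
    exact MeanHolder.right_top ht _
  · have hp' : 1 < p⁻¹ := (one_lt_inv₀ hp0).2 hp1
    have := MeanHolder.of_reciprocals ht (x := -p⁻¹) (y := p⁻¹ - 1) (by linarith)
      (.inr (by linarith))
    rw [show -p⁻¹ + (p⁻¹ - 1) = -1 by ring, inv_neg, inv_inv, inv_neg, inv_one] at this
    rwa [jacobianExp_of_lt_one hp0 hp1]

/-- The equation `1/p = (1 - p)/p + 1`. -/
lemma meanHolder_jacobianExp_one {p t : ℝ} (hp : p ∈ Icc (0 : ℝ) 1) (ht : t ∈ Icc (0 : ℝ) 1) :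
    MeanHolder t (jacobianExp p) ((1 : ℝ) : EReal) (p : EReal) := by
  rcases hp.1.eq_or_lt with rfl | hp0
  · exact MeanHolder.zero ht (by simp [jacobianExp]) (by simp)
  rcases hp.2.eq_or_lt with rfl | hp1
  · rw [jacobianExp, if_pos rfl]
    exact (MeanHolder.right_top ht _).comm
  · have hp' : 1 < p⁻¹ := (one_lt_inv₀ hp0).2 hp1
    have := MeanHolder.of_reciprocals ht (x := p⁻¹ - 1) zero_lt_one (.inl (by linarith))
    rw [sub_add_cancel, inv_inv, inv_one] at this
    rwa [jacobianExp_of_lt_one hp0 hp1]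

lemma isMarginalExp_top {t : ℝ} (ht : t ∈ Icc (0 : ℝ) 1) {p : ℝ} (hp : p ∈ Icc (0 : ℝ) 1) :
    IsMarginalExp p t ⊤ (p : EReal) :=
  ⟨_, (MeanHolder.right_top ht _).comm, meanHolder_jacobianExp_one hp ht⟩

lemma isIteratedMarginalExp_zero {t : ℝ} (ht : t ∈ Icc (0 : ℝ) 1) {p : ℝ}
    (hp : p ∈ Icc (0 : ℝ) 1) {α : EReal} (hα : 0 ≤ α) {n : ℕ} (hn : 0 < n) :
    IsIteratedMarginalExp p t n α 0 := by
  induction n, hn using Nat.le_induction with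
  | base => exact ⟨α, rfl, isMarginalExp_zero ht hp hα⟩
  | succ n _ ih => exact ⟨0, ih, isMarginalExp_zero ht hp le_rfl⟩

lemma isIteratedMarginalExp_top {t : ℝ} (ht : t ∈ Icc (0 : ℝ) 1) {p : ℝ} (hp0 : 0 < p)
    (hp1 : p ≤ 1) {n : ℕ} (hn : 0 < n) :
    IsIteratedMarginalExp p t n ⊤ ((p / n : ℝ) : EReal) := by
  induction n, hn using Nat.le_induction with
  | base => exact ⟨⊤, rfl, by simpa using isMarginalExp_top ht ⟨hp0.le, hp1⟩⟩
  | succ n hn ih =>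
    have hn' : (0 : ℝ) < n := by exact_mod_cast hn
    refine ⟨_, ih, ?_⟩
    convert isMarginalExp_inv ht hp0 hp1 (x := n / p) (.inl (by positivity)) using 2
    · field_simp
    · push_cast
      field_simp

lemma isIteratedMarginalExp_inv {t : ℝ} (ht : t ∈ Icc (0 : ℝ) 1) {p : ℝ} (hp0 : 0 < p)
    (hp1 : p ≤ 1) {x : ℝ} {n : ℕ} (hx : 0 < x ∨ x + n / p < 0) :
    IsIteratedMarginalExp p t n ((x⁻¹ : ℝ) : EReal) (((x + n / p)⁻¹ : ℝ) : EReal) := by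
  induction n with
  | zero => simp [IsIteratedMarginalExp]
  | succ n ih =>
    have hp' : 0 < p⁻¹ := inv_pos.2 hp0
    have e : x + ((n + 1 : ℕ) : ℝ) / p = x + n / p + p⁻¹ := by
      push_cast
      ring
    have hn : (0 : ℝ) ≤ n / p := by positivity
    rw [e] at hx ⊢
    exact ⟨_, ih (hx.imp_right fun h => by linarith),
      isMarginalExp_inv ht hp0 hp1 (hx.imp_left fun h => by linarith)⟩

lemma isIteratedMarginalExp_gammaExp {t : ℝ} (ht : t ∈ Icc (0 : ℝ) 1) {p : ℝ}
    (hp : p ∈ Icc (0 : ℝ) 1) {n : ℕ} (hn : 0 < n) {α : EReal}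
    (hα : ((-(p / n) : ℝ) : EReal) ≤ α) : IsIteratedMarginalExp p t n α (gammaExp n p α) := by
  rw [gammaExp]
  split_ifs with h0 htop hbot
  · refine isIteratedMarginalExp_zero ht hp ?_ hn
    rcases h0 with rfl | rfl
    · simpa using hα
    · exact le_rfl
  · rw [htop]
    exact isIteratedMarginalExp_top ht (hp.1.lt_of_ne' fun h => h0 (.inl h)) hp.2 hn
  · have hp0 : 0 < p := hp.1.lt_of_ne' fun h => h0 (.inl h)
    -- After all but one of the integrations the exponent is `-p`, and the last one leads to `-∞`.
    obtain ⟨m, rfl⟩ := Nat.exists_eq_add_one.2 hn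
    have e : -(((m + 1 : ℕ) : ℝ) / p) + m / p = (-p)⁻¹ := by
      push_cast
      field_simp
      ring
    have h1 := isIteratedMarginalExp_inv ht hp0 hp.2 (n := m)
      (x := -(((m + 1 : ℕ) : ℝ) / p)) (.inr (by rw [e]; exact inv_lt_zero.2 (by linarith)))
    rw [e, inv_inv, inv_neg, inv_div, ← hbot] at h1
    exact ⟨_, h1, isMarginalExp_bot ht hp0 hp.2⟩
  · have hp0 : 0 < p := hp.1.lt_of_ne' fun h => h0 (.inl h)
    have hn' : (0 : ℝ) < n := by exact_mod_cast hn
    induction α with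
    | bot => simp at hα
    | top => exact absurd rfl htop
    | coe a =>
      have hlt : -(p / n) < a := EReal.coe_lt_coe_iff.1 (hα.lt_of_ne' hbot)
      have ha0 : a ≠ 0 := fun h => h0 (.inr (by rw [h]; rfl))
      have := isIteratedMarginalExp_inv ht hp0 hp.2 (n := n) (x := a⁻¹) (by
        rcases ha0.lt_or_gt with h | h
        · right
          have h1 : (-a)⁻¹ > (p / n)⁻¹ := by
            gcongr
            · linarith
            · linarith
          rw [inv_neg, inv_div] at h1
          linarith
        · exact .inl (inv_pos.2 h))
      rw [inv_inv, add_comm] at this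
      simpa using this

end

noncomputable section

/-! ### Superadditivity of means and the Firey combination -/

lemma pMean_le_arith {p t : ℝ} (hp : p ∈ Icc (0 : ℝ) 1) (ht : t ∈ Icc (0 : ℝ) 1) {a b : ℝ≥0∞}
    (ha : a ≠ 0) (hb : b ≠ 0) (ha' : a ≠ ⊤) (hb' : b ≠ ⊤) :
    pMean (p : EReal) t a b ≤ ENNReal.ofReal (1 - t) * a + ENNReal.ofReal t * b := by
  have := meanHolder_jacobianExp_one hp ht one_ne_zero one_ne_zero ha hb ENNReal.one_ne_top
    ENNReal.one_ne_top ha' hb'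
  rwa [one_mul, one_mul, pMean_self ht, one_mul, pMean_one] at this

/-- The equality case of Hölder's inequality for means. -/
lemma pMean_jacobianExp_mul {p t : ℝ} (hp : p ∈ Icc (0 : ℝ) 1) (ht : t ∈ Icc (0 : ℝ) 1)
    {a b : ℝ≥0∞} (ha : a ≠ 0) (hb : b ≠ 0) (ha' : a ≠ ⊤) (hb' : b ≠ ⊤) :
    pMean (jacobianExp p) t (a ^ (1 - p)) (b ^ (1 - p)) *
      (ENNReal.ofReal (1 - t) * a ^ p + ENNReal.ofReal t * b ^ p) = pMean (p : EReal) t a b := by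
  rcases hp.1.eq_or_lt with rfl | hp0
  · simp [jacobianExp, ofReal_one_sub_add ht]
  rcases hp.2.eq_or_lt with rfl | hp1
  · rw [pMean_one]
    simp [jacobianExp, pMean_self ht]
  · have h1 : 0 < 1 - p := sub_pos.2 hp1
    have hr : p / (1 - p) ≠ 0 := (div_pos hp0 h1).ne'
    rw [jacobianExp, if_neg hp1.ne, pMean_coe hr, pMean_coe hp0.ne', ← ENNReal.rpow_mul,
      ← ENNReal.rpow_mul, mul_div_cancel₀ _ h1.ne']
    set X := ENNReal.ofReal (1 - t) * a ^ p + ENNReal.ofReal t * b ^ p with hX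
    have hXp : X ^ p⁻¹ = pMean (p : EReal) t a b := by rw [pMean_coe hp0.ne', one_div]
    have hX0 : X ≠ 0 := by
      intro h
      apply pMean_ne_zero ht p ha hb
      rw [← hXp, h, ENNReal.zero_rpow_of_pos (inv_pos.2 hp0)]
    have hX1 : X ≠ ⊤ := by
      intro h
      apply pMean_ne_top ht p ha' hb'
      rw [← hXp, h, ENNReal.top_rpow_of_pos (inv_pos.2 hp0)]
    nth_rewrite 2 [← ENNReal.rpow_one X]
    rw [← ENNReal.rpow_add _ _ hX0 hX1]
    congr 1
    field_simp
    ring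

/-- The reverse Minkowski inequality: `p`-means with `p ≤ 1` are superadditive, because they are
infima of weighted sums by Hölder's inequality for means. -/
lemma sum_pMean_mul_le {ι : Type*} [Fintype ι] {p t : ℝ} (hp : p ∈ Icc (0 : ℝ) 1)
    (ht : t ∈ Icc (0 : ℝ) 1) {a b w : ι → ℝ≥0∞} (ha : ∀ i, a i ≠ 0) (hb : ∀ i, b i ≠ 0)
    (ha' : ∀ i, a i ≠ ⊤) (hb' : ∀ i, b i ≠ ⊤) (hw : ∀ i, w i ≠ ⊤) :
    ∑ i, pMean (p : EReal) t (a i) (b i) * w i ≤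
      pMean (p : EReal) t (∑ i, a i * w i) (∑ i, b i * w i) := by
  by_cases hw0 : ∀ i, w i = 0
  · simp [hw0]
  push Not at hw0
  obtain ⟨j, hj⟩ := hw0
  set S := ∑ i, a i * w i with hS
  set T := ∑ i, b i * w i with hT
  have hsum0 {a : ι → ℝ≥0∞} (ha : ∀ i, a i ≠ 0) : ∑ i, a i * w i ≠ 0 := fun h =>
    mul_ne_zero (ha j) hj (Finset.sum_eq_zero_iff.1 h j (Finset.mem_univ j))
  have hsumt {a : ι → ℝ≥0∞} (ha : ∀ i, a i ≠ ⊤) : ∑ i, a i * w i ≠ ⊤ :=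
    ENNReal.sum_ne_top.2 fun i _ => ENNReal.mul_ne_top (ha i) (hw i)
  have hS0 : S ≠ 0 := hsum0 ha
  have hT0 : T ≠ 0 := hsum0 hb
  have hSt : S ≠ ⊤ := hsumt ha'
  have hTt : T ≠ ⊤ := hsumt hb'
  have hp1 : 0 ≤ 1 - p := sub_nonneg.2 hp.2
  have pow0 {x : ℝ≥0∞} (hx : x ≠ 0) (hxt : x ≠ ⊤) : x ^ (1 - p) ≠ 0 := by
    simp [ENNReal.rpow_eq_zero_iff, hx, hxt]
  have powt {x : ℝ≥0∞} (hxt : x ≠ ⊤) : x ^ (1 - p) ≠ ⊤ := ENNReal.rpow_ne_top_of_nonneg hp1 hxt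
  have hdiv {x : ℝ≥0∞} (hx : x ≠ 0) (hxt : x ≠ ⊤) : (x ^ (1 - p))⁻¹ * x = x ^ p := by
    rw [← ENNReal.rpow_neg]
    nth_rewrite 2 [← ENNReal.rpow_one x]
    rw [← ENNReal.rpow_add _ _ hx hxt]
    congr 1
    ring
  set P := pMean (jacobianExp p) t (S ^ (1 - p)) (T ^ (1 - p)) with hP
  have hi (i) : pMean (p : EReal) t (a i) (b i) ≤
      P * (ENNReal.ofReal (1 - t) * ((S ^ (1 - p))⁻¹ * a i) +
        ENNReal.ofReal t * ((T ^ (1 - p))⁻¹ * b i)) := by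
    have := meanHolder_jacobianExp_one hp ht (pow0 hS0 hSt) (pow0 hT0 hTt)
      (c := (S ^ (1 - p))⁻¹ * a i) (d := (T ^ (1 - p))⁻¹ * b i)
      (mul_ne_zero (ENNReal.inv_ne_zero.2 (powt hSt)) (ha i))
      (mul_ne_zero (ENNReal.inv_ne_zero.2 (powt hTt)) (hb i)) (powt hSt) (powt hTt)
      (ENNReal.mul_ne_top (ENNReal.inv_ne_top.2 (pow0 hS0 hSt)) (ha' i))
      (ENNReal.mul_ne_top (ENNReal.inv_ne_top.2 (pow0 hT0 hTt)) (hb' i))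
    rwa [ENNReal.mul_inv_cancel_left (pow0 hS0 hSt) (powt hSt),
      ENNReal.mul_inv_cancel_left (pow0 hT0 hTt) (powt hTt), pMean_one] at this
  calc ∑ i, pMean (p : EReal) t (a i) (b i) * w i
      ≤ ∑ i, P * (ENNReal.ofReal (1 - t) * ((S ^ (1 - p))⁻¹ * a i) +
        ENNReal.ofReal t * ((T ^ (1 - p))⁻¹ * b i)) * w i := by
        gcongr with i
        exact hi i
    _ = P * (ENNReal.ofReal (1 - t) * ((S ^ (1 - p))⁻¹ * S) +
        ENNReal.ofReal t * ((T ^ (1 - p))⁻¹ * T)) := by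
        simp only [hS, hT, Finset.mul_sum, mul_assoc, add_mul, Finset.sum_add_distrib, mul_add]
    _ = pMean (p : EReal) t S T := by
        rw [hdiv hS0 hSt, hdiv hT0 hTt]
        exact pMean_jacobianExp_mul hp ht hS0 hT0 hSt hTt

variable {n : ℕ}

@[simp] lemma signFlip_apply (ε : Fin n → ℤˣ) (x : EuclideanSpace ℝ (Fin n)) (i : Fin n) :
    signFlip ε x i = ((ε i : ℤ) : ℝ) * x i := rfl

lemma units_mul_self_real (e : ℤˣ) : ((e : ℤ) : ℝ) * ((e : ℤ) : ℝ) = 1 := by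
  rcases Int.units_eq_one_or e with h | h <;> simp [h]

lemma abs_units_real (e : ℤˣ) : |((e : ℤ) : ℝ)| = 1 := by
  rcases Int.units_eq_one_or e with h | h <;> simp [h]

lemma signFlip_signFlip (ε δ : Fin n → ℤˣ) (x : EuclideanSpace ℝ (Fin n)) :
    signFlip ε (signFlip δ x) = signFlip (ε * δ) x := by
  ext i
  simp [mul_assoc]

lemma signFlip_self (ε : Fin n → ℤˣ) (x : EuclideanSpace ℝ (Fin n)) :
    signFlip ε (signFlip ε x) = x := by
  ext i
  rw [signFlip_apply, signFlip_apply, ← mul_assoc, units_mul_self_real, one_mul]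

lemma signFlip_combination (ε : Fin n → ℤˣ) (a b : ℝ) (x y : EuclideanSpace ℝ (Fin n)) :
    signFlip ε (a • x + b • y) = a • signFlip ε x + b • signFlip ε y := by
  ext i
  simp
  ring

lemma inner_signFlip (ε : Fin n → ℤˣ) (x u : EuclideanSpace ℝ (Fin n)) :
    inner ℝ (signFlip ε x) u = inner ℝ x (signFlip ε u) := by
  simp only [PiLp.inner_apply, signFlip_apply, RCLike.inner_apply, conj_trivial]
  exact Finset.sum_congr rfl fun i _ => by ring

lemma norm_signFlip (ε : Fin n → ℤˣ) (x : EuclideanSpace ℝ (Fin n)) : ‖signFlip ε x‖ = ‖x‖ := by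
  simp [EuclideanSpace.norm_eq, abs_units_real]

/-- A change of signs of the coordinates as a linear isometry. -/
def signFlipIsometry (ε : Fin n → ℤˣ) :
    EuclideanSpace ℝ (Fin n) ≃ₗᵢ[ℝ] EuclideanSpace ℝ (Fin n) where
  toFun := signFlip ε
  invFun := signFlip ε
  left_inv := signFlip_self ε
  right_inv := signFlip_self ε
  map_add' x y := by simpa using signFlip_combination ε 1 1 x y
  map_smul' a x := by simpa using signFlip_combination ε a 0 x 0
  norm_map' := norm_signFlip ε

lemma measurePreserving_signFlip (ε : Fin n → ℤˣ) :
    MeasurePreserving (signFlip ε) (volume : Measure (EuclideanSpace ℝ (Fin n))) volume :=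
  (signFlipIsometry ε).measurePreserving

lemma measurableEmbedding_signFlip (ε : Fin n → ℤˣ) :
    MeasurableEmbedding (signFlip ε : EuclideanSpace ℝ (Fin n) → EuclideanSpace ℝ (Fin n)) :=
  (signFlipIsometry ε).toHomeomorph.measurableEmbedding

lemma inner_le_supportFn {A : Set (EuclideanSpace ℝ (Fin n))} (hA : IsCompact A)
    {x : EuclideanSpace ℝ (Fin n)} (hx : x ∈ A) (u : EuclideanSpace ℝ (Fin n)) :
    inner ℝ x u ≤ supportFn A u :=
  le_csSup (hA.image (by fun_prop)).bddAbove (mem_image_of_mem _ hx)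

lemma supportFn_signFlip {A : Set (EuclideanSpace ℝ (Fin n))} (hA : IsUnconditionalSet A)
    (ε : Fin n → ℤˣ) (u : EuclideanSpace ℝ (Fin n)) :
    supportFn A (signFlip ε u) = supportFn A u := by
  unfold supportFn
  congr 1
  ext r
  constructor
  · rintro ⟨x, hx, rfl⟩
    exact ⟨signFlip ε x, (hA ε x).2 hx, inner_signFlip ε x u⟩
  · rintro ⟨x, hx, rfl⟩
    exact ⟨signFlip ε x, (hA ε x).2 hx, by simp only [inner_signFlip, signFlip_self]⟩

lemma isUnconditionalSet_fireyComb {A B : Set (EuclideanSpace ℝ (Fin n))}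
    (hA : IsUnconditionalSet A) (hB : IsUnconditionalSet B) (p : EReal) (t : ℝ) :
    IsUnconditionalSet (fireyComb p t A B) := by
  have key (ε : Fin n → ℤˣ) (x) (hx : x ∈ fireyComb p t A B) :
      signFlip ε x ∈ fireyComb p t A B := by
    intro u hu
    rw [inner_signFlip, ← supportFn_signFlip hA ε u, ← supportFn_signFlip hB ε u]
    exact hx _ (by simpa [norm_signFlip] using hu)
  exact fun ε x => ⟨fun h => signFlip_self ε x ▸ key ε _ h, key ε x⟩

lemma isClosed_fireyComb (A B : Set (EuclideanSpace ℝ (Fin n))) (p : EReal) (t : ℝ) :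
    IsClosed (fireyComb p t A B) := by
  simp only [fireyComb, ofPred_forall]
  refine isClosed_iInter fun u => isClosed_iInter fun _ => ?_
  exact isClosed_le (ENNReal.continuous_ofReal.comp (by fun_prop)) continuous_const

/-- The sum `∑ xᵢ |uᵢ|` is the inner product of `u` with a sign change of `x`. -/
lemma sum_mul_abs_le_supportFn {A : Set (EuclideanSpace ℝ (Fin n))} (hA : IsCompact A)
    (hAu : IsUnconditionalSet A) {x : EuclideanSpace ℝ (Fin n)} (hx : x ∈ A)
    (u : EuclideanSpace ℝ (Fin n)) : ∑ i, x i * |u i| ≤ supportFn A u := by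
  refine le_of_eq_of_le ?_
    (inner_le_supportFn hA ((hAu (fun i => if 0 ≤ u i then 1 else -1) x).2 hx) u)
  simp only [PiLp.inner_apply, signFlip_apply, RCLike.inner_apply, conj_trivial]
  refine Finset.sum_congr rfl fun i _ => ?_
  split_ifs with h
  · simp [abs_of_nonneg h, mul_comm]
  · simp [abs_of_neg (not_le.1 h), mul_comm]

lemma realMean_mem_fireyComb {p t : ℝ} (hp : p ∈ Icc (0 : ℝ) 1) (ht : t ∈ Icc (0 : ℝ) 1)
    {A B : Set (EuclideanSpace ℝ (Fin n))} (hA : IsCompact A) (hAu : IsUnconditionalSet A)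
    (hB : IsCompact B) (hBu : IsUnconditionalSet B) {x y : EuclideanSpace ℝ (Fin n)}
    (hx : x ∈ A) (hy : y ∈ B) (hx0 : ∀ i, 0 < x i) (hy0 : ∀ i, 0 < y i) :
    WithLp.toLp 2 (fun i => realMean p t (x i) (y i)) ∈ fireyComb (p : EReal) t A B := by
  intro u _
  have hsum (x : EuclideanSpace ℝ (Fin n)) (hx0 : ∀ i, 0 < x i) :
      ∑ i, ENNReal.ofReal (x i) * ENNReal.ofReal |u i| = ENNReal.ofReal (∑ i, x i * |u i|) := by
    rw [ENNReal.ofReal_sum_of_nonneg fun i _ => mul_nonneg (hx0 i).le (abs_nonneg _)]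
    exact Finset.sum_congr rfl fun i _ => (ENNReal.ofReal_mul (hx0 i).le).symm
  calc ENNReal.ofReal (inner ℝ (WithLp.toLp 2 fun i => realMean p t (x i) (y i)) u)
      ≤ ENNReal.ofReal (∑ i, realMean p t (x i) (y i) * |u i|) := by
        refine ENNReal.ofReal_le_ofReal ?_
        simp only [PiLp.inner_apply, RCLike.inner_apply, conj_trivial]
        refine Finset.sum_le_sum fun i _ => ?_
        rw [mul_comm]
        exact mul_le_mul_of_nonneg_left (le_abs_self _) (realMean_pos ht (hx0 i) (hy0 i)).le
    _ = ∑ i, pMean (p : EReal) t (ENNReal.ofReal (x i)) (ENNReal.ofReal (y i)) *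
          ENNReal.ofReal |u i| := by
        rw [← hsum (WithLp.toLp 2 fun i => realMean p t (x i) (y i))
          fun i => realMean_pos ht (hx0 i) (hy0 i)]
        simp only [ofReal_realMean ht]
    _ ≤ pMean (p : EReal) t (∑ i, ENNReal.ofReal (x i) * ENNReal.ofReal |u i|)
          (∑ i, ENNReal.ofReal (y i) * ENNReal.ofReal |u i|) :=
        sum_pMean_mul_le hp ht (fun i => by simpa using hx0 i) (fun i => by simpa using hy0 i)
          (fun i => ENNReal.ofReal_ne_top) (fun i => ENNReal.ofReal_ne_top)
          fun i => ENNReal.ofReal_ne_top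
    _ ≤ _ := by
        rw [hsum x hx0, hsum y hy0]
        exact pMean_mono ht _ (ENNReal.ofReal_le_ofReal (sum_mul_abs_le_supportFn hA hAu hx u))
          (ENNReal.ofReal_le_ofReal (sum_mul_abs_le_supportFn hB hBu hy u))

end

noncomputable section

variable {n : ℕ}

/-! ### Unconditional measures and densities -/

/-- The open positive orthant of `ℝⁿ`. -/
def openOrthant (n : ℕ) : Set (EuclideanSpace ℝ (Fin n)) := {x | ∀ i, 0 < x i}

lemma isOpen_openOrthant : IsOpen (openOrthant n) := by
  simp only [openOrthant, ofPred_forall]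
  exact isOpen_iInter_of_finite fun i => isOpen_lt continuous_const (by fun_prop)

lemma volume_eq_zero_of_exists_coord :
    volume {x : EuclideanSpace ℝ (Fin n) | ∃ i, x i = 0} = 0 := by
  rw [ofPred_exists, measure_iUnion_null_iff]
  intro i
  have h := (PiLp.volume_preserving_ofLp (Fin n)).measure_preimage
    (s := {x : Fin n → ℝ | x i = 0})
    (measurableSet_eq_fun (measurable_pi_apply i) measurable_const).nullMeasurableSet
  exact h.trans (Measure.pi_hyperplane (fun _ => volume) i 0)

/-- The `2ⁿ` open orthants carry the same mass, and the coordinate hyperplanes carry none. -/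
lemma measure_eq_card_mul_openOrthant {μ : Measure (EuclideanSpace ℝ (Fin n))}
    (hμ : IsUnconditionalMeasure μ) (hac : μ ≪ volume) {S : Set (EuclideanSpace ℝ (Fin n))}
    (hS : MeasurableSet S) (hSu : IsUnconditionalSet S) :
    μ S = Fintype.card (Fin n → ℤˣ) * μ (S ∩ openOrthant n) := by
  have hmeas : MeasurableSet (S ∩ openOrthant n) := hS.inter isOpen_openOrthant.measurableSet
  have hdisj : Pairwise (Function.onFun Disjoint
      fun ε : Fin n → ℤˣ => signFlip ε ⁻¹' (S ∩ openOrthant n)) := by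
    intro ε δ hne
    refine Set.disjoint_left.2 fun x hx hx' => hne ?_
    ext1 i
    have h1 := hx.2 i
    have h2 := hx'.2 i
    rw [signFlip_apply] at h1 h2
    rcases Int.units_eq_one_or (ε i) with h | h <;>
      rcases Int.units_eq_one_or (δ i) with h' | h' <;>
      simp only [h, h', Units.val_one, Units.val_neg, Int.cast_one, Int.cast_neg] at h1 h2 ⊢ <;>
      linarith
  have hunion : μ S = μ (⋃ ε : Fin n → ℤˣ, signFlip ε ⁻¹' (S ∩ openOrthant n)) := by
    refine le_antisymm ?_ (measure_mono (iUnion_subset fun ε x hx => (hSu ε x).1 hx.1))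
    have h0 : μ {x : EuclideanSpace ℝ (Fin n) | ∃ i, x i = 0} = 0 :=
      hac volume_eq_zero_of_exists_coord
    refine (measure_mono (t := (⋃ ε : Fin n → ℤˣ, signFlip ε ⁻¹' (S ∩ openOrthant n)) ∪
      {x | ∃ i, x i = 0}) fun x hx => ?_).trans
      ((measure_union_le _ _).trans (by rw [h0, add_zero]))
    by_cases hx0 : ∃ i, x i = 0
    · exact .inr hx0
    · push Not at hx0
      refine .inl (mem_iUnion.2 ⟨fun i => if 0 ≤ x i then 1 else -1, (hSu _ x).2 hx, fun i => ?_⟩)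
      rw [signFlip_apply]
      split_ifs with h
      · simpa using h.lt_of_ne' (hx0 i)
      · simpa using h
  rw [hunion, measure_iUnion hdisj fun ε => (hμ ε).measurable hmeas, tsum_fintype]
  simp only [(hμ _).measure_preimage hmeas.nullMeasurableSet, Finset.sum_const, Finset.card_univ,
    nsmul_eq_mul]

/-- The largest unconditional function below `f`. -/
def unconditionalMinorant (f : EuclideanSpace ℝ (Fin n) → ℝ≥0) (x : EuclideanSpace ℝ (Fin n)) :
    ℝ≥0∞ :=
  ⨅ ε : Fin n → ℤˣ, (f (signFlip ε x) : ℝ≥0∞)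

lemma unconditionalMinorant_le (f : EuclideanSpace ℝ (Fin n) → ℝ≥0) (ε : Fin n → ℤˣ)
    (x : EuclideanSpace ℝ (Fin n)) : unconditionalMinorant f x ≤ f (signFlip ε x) :=
  iInf_le (fun ε : Fin n → ℤˣ => (f (signFlip ε x) : ℝ≥0∞)) ε

lemma unconditionalMinorant_ne_top (f : EuclideanSpace ℝ (Fin n) → ℝ≥0)
    (x : EuclideanSpace ℝ (Fin n)) : unconditionalMinorant f x ≠ ⊤ :=
  ((unconditionalMinorant_le f 1 x).trans_lt ENNReal.coe_lt_top).ne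

lemma unconditionalMinorant_signFlip (f : EuclideanSpace ℝ (Fin n) → ℝ≥0) (ε : Fin n → ℤˣ)
    (x : EuclideanSpace ℝ (Fin n)) :
    unconditionalMinorant f (signFlip ε x) = unconditionalMinorant f x := by
  simp only [unconditionalMinorant, signFlip_signFlip]
  exact (Equiv.mulRight ε).iInf_congr fun δ => rfl

/-- An unconditional measure determines its density up to null sets, so that its density is almost
everywhere invariant under sign changes. -/
lemma unconditionalMinorant_ae_eq {f : EuclideanSpace ℝ (Fin n) → ℝ≥0}
    (hf : AEMeasurable f volume)
    (hμ : IsUnconditionalMeasure (volume.withDensity fun x => (f x : ℝ≥0∞))) :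
    unconditionalMinorant f =ᵐ[volume] fun x => (f x : ℝ≥0∞) := by
  have h (ε : Fin n → ℤˣ) : (fun x => (f (signFlip ε x) : ℝ≥0∞)) =ᵐ[volume]
      fun x => (f x : ℝ≥0∞) := by
    have hε := measurePreserving_signFlip ε
    refine (withDensity_eq_iff_of_sigmaFinite
      (hf.comp_quasiMeasurePreserving hε.quasiMeasurePreserving).coe_nnreal_ennreal
      hf.coe_nnreal_ennreal).1 ?_
    ext s hs
    have hpre : signFlip ε ⁻¹' (signFlip ε ⁻¹' s) = s := by
      ext x
      simp [signFlip_self]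
    have h1 := hε.setLIntegral_comp_preimage_emb (measurableEmbedding_signFlip ε)
      (fun x => (f x : ℝ≥0∞)) (signFlip ε ⁻¹' s)
    rw [hpre] at h1
    rw [withDensity_apply _ hs, ← (hμ ε).measure_preimage hs.nullMeasurableSet,
      withDensity_apply _ (hε.measurable hs)]
    exact h1
  filter_upwards [ae_all_iff.2 h] with x hx
  simp [unconditionalMinorant, hx]

lemma pMean_unconditionalMinorant_le {α : EReal} {f : EuclideanSpace ℝ (Fin n) → ℝ≥0}
    (hf : IsAlphaConcave α f) {t : ℝ} (ht : t ∈ Icc (0 : ℝ) 1) {x y : EuclideanSpace ℝ (Fin n)}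
    (hx : unconditionalMinorant f x ≠ 0) (hy : unconditionalMinorant f y ≠ 0) :
    pMean α t (unconditionalMinorant f x) (unconditionalMinorant f y) ≤
      unconditionalMinorant f ((1 - t) • x + t • y) := by
  have hpos {x} (hx : unconditionalMinorant f x ≠ 0) (ε) : 0 < f (signFlip ε x) := by
    have := (pos_iff_ne_zero.2 hx).trans_le (unconditionalMinorant_le f ε x)
    exact_mod_cast this
  refine le_iInf fun ε => ?_
  rw [signFlip_combination]
  exact (pMean_mono ht α (unconditionalMinorant_le f ε x) (unconditionalMinorant_le f ε y)).trans
    (hf _ _ (mul_pos (hpos hx ε) (hpos hy ε)) t ht)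

/-- On the line through `x` in a coordinate direction, a point between `x` and its reflection is a
convex combination of the two; changing the coordinates one at a time gives monotonicity in each
`|xᵢ|`. -/
lemma unconditionalMinorant_antitone {α : EReal} {f : EuclideanSpace ℝ (Fin n) → ℝ≥0}
    (hf : IsAlphaConcave α f) {x z : EuclideanSpace ℝ (Fin n)} (hzx : ∀ i, |z i| ≤ |x i|) :
    unconditionalMinorant f x ≤ unconditionalMinorant f z := by
  classical
  suffices key : ∀ (s : Finset (Fin n)) (z : EuclideanSpace ℝ (Fin n)), (∀ i, |z i| ≤ |x i|) →
      (∀ i ∉ s, z i = x i) → unconditionalMinorant f x ≤ unconditionalMinorant f z from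
    key Finset.univ z hzx (by simp)
  intro s
  induction s using Finset.induction_on with
  | empty =>
    intro z _ hz
    rw [show z = x by ext i; exact hz i (by simp)]
  | insert j s hj ih =>
    intro z hzx hz
    set w : EuclideanSpace ℝ (Fin n) := WithLp.toLp 2 (Function.update z.ofLp j (x j)) with hw
    have hwj : w j = x j := by simp [hw]
    have hwi {i} (hi : i ≠ j) : w i = z i := by simp [hw, hi]
    have hxw : unconditionalMinorant f x ≤ unconditionalMinorant f w := by
      refine ih w (fun i => ?_) fun i hi => ?_
      · rcases eq_or_ne i j with rfl | h
        · rw [hwj]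
        · rw [hwi h]; exact hzx i
      · rcases eq_or_ne i j with rfl | h
        · exact hwj
        · rw [hwi h]; exact hz i (by simp [h, hi])
    refine hxw.trans ?_
    by_cases h0 : unconditionalMinorant f w = 0
    · simp [h0]
    have hzj := hzx j
    set ε : Fin n → ℤˣ := Function.update 1 j (-1) with hε
    have hcomb : ∃ t ∈ Icc (0 : ℝ) 1, (1 - t) * x j + t * (-x j) = z j := by
      rcases eq_or_ne (x j) 0 with hx0 | hx0
      · refine ⟨0, by simp, ?_⟩
        rw [hx0, abs_zero] at hzj
        simp [hx0, abs_nonpos_iff.1 hzj]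
      · refine ⟨(1 - z j / x j) / 2, ?_, by field_simp; ring⟩
        have : |z j / x j| ≤ 1 := by
          rw [abs_div]
          exact div_le_one_of_le₀ hzj (abs_nonneg _)
        have := abs_le.1 this
        constructor <;> linarith
    obtain ⟨t, ht, htz⟩ := hcomb
    have hzw : (1 - t) • w + t • signFlip ε w = z := by
      ext i
      rcases eq_or_ne i j with rfl | h
      · simpa [hε, hwj] using htz
      · simp [hε, h, hwi h]
        ring
    have := pMean_unconditionalMinorant_le hf ht h0
      (by rwa [unconditionalMinorant_signFlip] : unconditionalMinorant f (signFlip ε w) ≠ 0)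
    rwa [unconditionalMinorant_signFlip, pMean_self ht, hzw] at this

lemma setLIntegral_comp_smul {r : ℝ} (hr : 0 < r) (g : EuclideanSpace ℝ (Fin n) → ℝ≥0∞)
    (A : Set (EuclideanSpace ℝ (Fin n))) :
    ∫⁻ x in (fun x => r⁻¹ • x) ⁻¹' A, g x = ENNReal.ofReal (r ^ n) * ∫⁻ x in A, g (r • x) := by
  have he : MeasurableEmbedding fun x : EuclideanSpace ℝ (Fin n) => r • x :=
    (Homeomorph.smulOfNeZero r hr.ne').measurableEmbedding
  have h1 := he.lintegral_map (μ := volume.restrict A) g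
  have hpre : A = (fun x => r • x) ⁻¹' ((fun x => r⁻¹ • x) ⁻¹' A) := by
    ext x
    simp [smul_smul, inv_mul_cancel₀ hr.ne']
  nth_rewrite 1 [hpre] at h1
  rw [← he.restrict_map, Measure.map_addHaar_smul volume hr.ne', Measure.restrict_smul,
    lintegral_smul_measure, finrank_euclideanSpace_fin, smul_eq_mul] at h1
  have hrn : 0 < r ^ n := by positivity
  rw [← h1, ← mul_assoc, ← ENNReal.ofReal_mul hrn.le, abs_of_pos (inv_pos.2 hrn),
    mul_inv_cancel₀ hrn.ne', ENNReal.ofReal_one, one_mul]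

end

noncomputable section

variable {n : ℕ}

/-! ### Regularisation on the open orthant, and the conclusion -/

/-- The lower semicontinuous function `x ↦ lim_{r ↓ 1} g (r x)` on the open orthant, extended by
`0`, for `g` antitone along rays. The density itself need not be Borel measurable, so that Tonelli's
theorem is applied to this function. -/
def orthantRegularization (g : EuclideanSpace ℝ (Fin n) → ℝ≥0∞) :
    EuclideanSpace ℝ (Fin n) → ℝ≥0∞ :=
  (openOrthant n).indicator fun x => ⨆ r : Ioi (1 : ℝ), g (r.1 • x)

lemma orthantRegularization_apply (g : EuclideanSpace ℝ (Fin n) → ℝ≥0∞)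
    {x : EuclideanSpace ℝ (Fin n)} (hx : x ∈ openOrthant n) :
    orthantRegularization g x = ⨆ r : Ioi (1 : ℝ), g (r.1 • x) :=
  indicator_of_mem hx _

lemma le_orthantRegularization (g : EuclideanSpace ℝ (Fin n) → ℝ≥0∞)
    {x : EuclideanSpace ℝ (Fin n)} (hx : x ∈ openOrthant n) {r : ℝ} (hr : 1 < r) :
    g (r • x) ≤ orthantRegularization g x := by
  rw [orthantRegularization_apply g hx]
  exact le_iSup (fun r : Ioi (1 : ℝ) => g (r.1 • x)) ⟨r, hr⟩

section

variable {g : EuclideanSpace ℝ (Fin n) → ℝ≥0∞}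

lemma orthantRegularization_le (hg : ∀ x z, (∀ i, |z i| ≤ |x i|) → g x ≤ g z)
    (x : EuclideanSpace ℝ (Fin n)) : orthantRegularization g x ≤ g x := by
  refine indicator_le (g := g) (fun x _ => iSup_le fun r => hg _ _ fun i => ?_) x
  have hr : (1 : ℝ) < r.1 := r.2
  rw [PiLp.smul_apply, smul_eq_mul, abs_mul, abs_of_pos (by linarith : 0 < r.1)]
  exact le_mul_of_one_le_left (abs_nonneg _) hr.le

lemma measurable_orthantRegularization (hg : ∀ x z, (∀ i, |z i| ≤ |x i|) → g x ≤ g z) :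
    Measurable (orthantRegularization g) := by
  refine LowerSemicontinuous.measurable fun x q hq => ?_
  have hx : x ∈ openOrthant n := mem_of_indicator_ne_zero (pos_of_gt hq).ne'
  simp only [gt_iff_lt, orthantRegularization_apply g hx] at hq
  obtain ⟨⟨r, hr : 1 < r⟩, hqr⟩ := lt_iSup_iff.1 hq
  have hs : 1 < (1 + r) / 2 := by linarith
  have hopen : IsOpen {y : EuclideanSpace ℝ (Fin n) | ∀ i, (1 + r) / 2 * y i < r * x i} := by
    simp only [ofPred_forall]
    exact isOpen_iInter_of_finite fun i => isOpen_lt (by fun_prop) continuous_const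
  filter_upwards [isOpen_openOrthant.mem_nhds hx, hopen.mem_nhds fun i =>
    mul_lt_mul_of_pos_right (by linarith : (1 + r) / 2 < r) (hx i)] with y hy hyx
  refine hqr.trans_le (le_trans (hg _ _ fun i => ?_) (le_orthantRegularization g hy hs))
  have h1 := hy i
  have h2 := hx i
  simp only [PiLp.smul_apply, smul_eq_mul]
  rw [abs_of_nonneg (by positivity), abs_of_nonneg (by positivity)]
  exact (hyx i).le

/-- Coordinatewise, the power mean of two points lies below their arithmetic mean, and `g` is
antitone; so `α`-concavity at the arithmetic mean gives the bound at the power mean. -/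
lemma pMean_orthantRegularization_le {α : EReal} {p t : ℝ} (hp : p ∈ Icc (0 : ℝ) 1)
    (ht : t ∈ Icc (0 : ℝ) 1) (hgt : ∀ x, g x ≠ ⊤) (hg : ∀ x z, (∀ i, |z i| ≤ |x i|) → g x ≤ g z)
    (hgc : ∀ x y, g x ≠ 0 → g y ≠ 0 → pMean α t (g x) (g y) ≤ g ((1 - t) • x + t • y))
    {x y : EuclideanSpace ℝ (Fin n)} (hx : orthantRegularization g x ≠ 0)
    (hy : orthantRegularization g y ≠ 0) :
    pMean α t (orthantRegularization g x) (orthantRegularization g y) ≤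
      orthantRegularization g (WithLp.toLp 2 fun i => realMean p t (x i) (y i)) := by
  have hxo : x ∈ openOrthant n := mem_of_indicator_ne_zero hx
  have hyo : y ∈ openOrthant n := mem_of_indicator_ne_zero hy
  refine ENNReal.le_of_forall_lt_one_mul_le fun θ hθ => ?_
  rcases eq_or_ne θ 0 with rfl | hθ0
  · simp
  have approx {x} (hx : orthantRegularization g x ≠ 0) :
      ∃ r : ℝ, 1 < r ∧ θ * orthantRegularization g x < g (r • x) := by
    have hxo : x ∈ openOrthant n := mem_of_indicator_ne_zero hx
    have hlt : θ * orthantRegularization g x < orthantRegularization g x := by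
      have := ENNReal.mul_lt_mul_left hx
        ((orthantRegularization_le hg x).trans_lt (hgt x).lt_top).ne hθ
      rwa [one_mul] at this
    nth_rewrite 2 [orthantRegularization_apply g hxo] at hlt
    obtain ⟨⟨r, hr⟩, h⟩ := lt_iSup_iff.1 hlt
    exact ⟨r, hr, h⟩
  have shrink {x} {r s : ℝ} (hr : 0 < r) (hrs : r ≤ s) : g (s • x) ≤ g (r • x) := by
    refine hg _ _ fun i => ?_
    simp only [PiLp.smul_apply, smul_eq_mul, abs_mul]
    rw [abs_of_pos hr, abs_of_pos (hr.trans_le hrs)]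
    gcongr
  obtain ⟨r₁, hr₁, h₁⟩ := approx hx
  obtain ⟨r₂, hr₂, h₂⟩ := approx hy
  set r := min r₁ r₂ with hr
  have hr1 : 1 < r := lt_min hr₁ hr₂
  have hr0 : 0 < r := by linarith
  have h₁' := h₁.trans_le (shrink hr0 (min_le_left _ _))
  have h₂' := h₂.trans_le (shrink hr0 (min_le_right _ _))
  rw [← pMean_mul_left ht α hθ0 (hθ.trans ENNReal.one_lt_top).ne]
  have hmo : WithLp.toLp 2 (fun i => realMean p t (x i) (y i)) ∈ openOrthant n :=
    fun i => realMean_pos ht (hxo i) (hyo i)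
  calc _ ≤ pMean α t (g (r • x)) (g (r • y)) := pMean_mono ht α h₁'.le h₂'.le
    _ ≤ g ((1 - t) • r • x + t • r • y) := hgc _ _ (pos_of_gt h₁').ne' (pos_of_gt h₂').ne'
    _ ≤ g (r • WithLp.toLp 2 fun i => realMean p t (x i) (y i)) := by
        refine hg _ _ fun i => ?_
        have hm := realMean_pos (p := p) ht (hxo i) (hyo i)
        have hxy := combination_pos ht (hxo i) (hyo i)
        have hle : realMean p t (x i) (y i) ≤ (1 - t) * x i + t * y i := by
          rw [← ENNReal.ofReal_le_ofReal_iff hxy.le, ofReal_realMean ht,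
            ENNReal.ofReal_add (mul_nonneg (sub_nonneg.2 ht.2) (hxo i).le)
              (mul_nonneg ht.1 (hyo i).le), ENNReal.ofReal_mul (sub_nonneg.2 ht.2),
            ENNReal.ofReal_mul ht.1]
          exact pMean_le_arith hp ht (by simpa using hxo i) (by simpa using hyo i)
            ENNReal.ofReal_ne_top ENNReal.ofReal_ne_top
        have e : ((1 - t) • r • x + t • r • y) i = r * ((1 - t) * x i + t * y i) := by
          simp
          ring
        rw [e]
        simp only [PiLp.smul_apply, smul_eq_mul]
        rw [abs_of_pos (mul_pos hr0 hm), abs_of_pos (mul_pos hr0 hxy)]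
        gcongr
    _ ≤ _ := le_orthantRegularization g hmo hr1

/-- Dilation by `r > 1` shows that the regularisation loses no mass: the factor `r ^ n` tends
to `1`. -/
lemma setLIntegral_le_orthantRegularization {A : Set (EuclideanSpace ℝ (Fin n))}
    (hA : Convex ℝ A) (hA0 : 0 ∈ A) (hAm : MeasurableSet A) :
    ∫⁻ x in A ∩ openOrthant n, g x ≤ ∫⁻ x in A, orthantRegularization g x := by
  have hbound (r : ℝ) (hr : 1 < r) : ∫⁻ x in A ∩ openOrthant n, g x ≤
      ENNReal.ofReal (r ^ n) * ∫⁻ x in A, orthantRegularization g x := by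
    have hr0 : 0 < r := by linarith
    calc ∫⁻ x in A ∩ openOrthant n, g x
        ≤ ∫⁻ x in (fun x => r⁻¹ • x) ⁻¹' (A ∩ openOrthant n), g x := by
          refine lintegral_mono_set fun x hx => ⟨?_, fun i => ?_⟩
          · exact hA.smul_mem_of_zero_mem hA0 hx.1 ⟨(inv_pos.2 hr0).le, inv_le_one_of_one_le₀ hr.le⟩
          · exact mul_pos (inv_pos.2 hr0) (hx.2 i)
      _ = ENNReal.ofReal (r ^ n) * ∫⁻ x in A ∩ openOrthant n, g (r • x) :=
          setLIntegral_comp_smul hr0 g _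
      _ ≤ ENNReal.ofReal (r ^ n) * ∫⁻ x in A ∩ openOrthant n, orthantRegularization g x := by
          gcongr _ * ?_
          exact setLIntegral_mono' (hAm.inter isOpen_openOrthant.measurableSet)
            fun x hx => le_orthantRegularization g hx.2 hr
      _ ≤ _ := by
          gcongr
          exact inter_subset_left
  have hlim : Filter.Tendsto
      (fun r : ℝ => ENNReal.ofReal (r ^ n) * ∫⁻ x in A, orthantRegularization g x)
      (nhdsWithin 1 (Ioi 1)) (nhds (1 * ∫⁻ x in A, orthantRegularization g x)) := by
    refine ENNReal.Tendsto.mul_const (Filter.Tendsto.mono_left ?_ nhdsWithin_le_nhds) (by simp)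
    have : Filter.Tendsto (fun r : ℝ => r ^ n) (nhds 1) (nhds (1 ^ n)) :=
      (continuous_pow n).tendsto 1
    simpa using ENNReal.tendsto_ofReal this
  rw [one_mul] at hlim
  exact ge_of_tendsto hlim (eventually_mem_nhdsWithin.mono hbound)

/-- The inequality of the theorem for the part of the mass that lies in the open orthant. -/
lemma pMean_setLIntegral_openOrthant_le {α : EReal} {p t : ℝ} (hp : p ∈ Icc (0 : ℝ) 1)
    (ht : t ∈ Icc (0 : ℝ) 1) (hgt : ∀ x, g x ≠ ⊤) (hg : ∀ x z, (∀ i, |z i| ≤ |x i|) → g x ≤ g z)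
    (hgc : ∀ x y, g x ≠ 0 → g y ≠ 0 → pMean α t (g x) (g y) ≤ g ((1 - t) • x + t • y))
    {γ : EReal} (hγ : IsIteratedMarginalExp p t n α γ) {A B : Set (EuclideanSpace ℝ (Fin n))}
    (hA : IsConvexBodyAtOrigin A) (hAu : IsUnconditionalSet A)
    (hB : IsConvexBodyAtOrigin B) (hBu : IsUnconditionalSet B)
    (hA0 : ∫⁻ x in A ∩ openOrthant n, g x ≠ 0) (hB0 : ∫⁻ x in B ∩ openOrthant n, g x ≠ 0) :
    pMean γ t (∫⁻ x in A ∩ openOrthant n, g x) (∫⁻ x in B ∩ openOrthant n, g x) ≤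
      ∫⁻ x in fireyComb (p : EReal) t A B ∩ openOrthant n, g x := by
  have hAm := hA.isCompact.measurableSet
  have hBm := hB.isCompact.measurableSet
  have hCm := (isClosed_fireyComb A B p t).measurableSet
  have hAle := setLIntegral_le_orthantRegularization (g := g) hA.convex
    (interior_subset hA.zero_mem_interior) hAm
  have hBle := setLIntegral_le_orthantRegularization (g := g) hB.convex
    (interior_subset hB.zero_mem_interior) hBm
  have hφ := measurable_orthantRegularization hg
  set φ := orthantRegularization g with hφdef
  have hφo {x} (hx : φ x ≠ 0) : x ∈ openOrthant n := mem_of_indicator_ne_zero hx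
  obtain ⟨R, hR⟩ := (hA.isCompact.union hB.isCompact).isBounded.exists_norm_le
  -- The restriction of `φ` to a set, as a function of the coordinates.
  set Φ : Set (EuclideanSpace ℝ (Fin n)) → (Fin n → ℝ) → ℝ≥0∞ :=
    fun S v => S.indicator φ (WithLp.toLp 2 v) with hΦ
  have hΦm {S} (hS : MeasurableSet S) : Measurable (Φ S) :=
    (hφ.indicator hS).comp (PiLp.volume_preserving_toLp (Fin n)).measurable
  have hΦint {S} (hS : MeasurableSet S) : ∫⁻ v, Φ S v = ∫⁻ x in S, φ x := by
    rw [← lintegral_indicator hS]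
    exact (PiLp.volume_preserving_toLp (Fin n)).lintegral_comp (hφ.indicator hS)
  have hΦne {S v} (hv : Φ S v ≠ 0) : WithLp.toLp 2 v ∈ S ∧ φ (WithLp.toLp 2 v) ≠ 0 := by
    have h := mem_of_indicator_ne_zero hv
    refine ⟨h, ?_⟩
    rwa [← indicator_of_mem h φ]
  have hΦval {S v} (hv : WithLp.toLp 2 v ∈ S) : Φ S v = φ (WithLp.toLp 2 v) :=
    indicator_of_mem hv _
  have hΦle (S v) : Φ S v ≤ g 0 :=
    (indicator_le_self _ _ _).trans ((orthantRegularization_le hg _).trans (hg _ _ (by simp)))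
  have hΦbox {S} (hS : S ⊆ A ∪ B) (v : Fin n → ℝ) (hv : Φ S v ≠ 0) (i : Fin n) :
      v i ∈ Ioo 0 (R + 1) := by
    obtain ⟨h1, h2⟩ := hΦne hv
    refine ⟨hφo h2 i, ?_⟩
    have h3 := (PiLp.norm_apply_le (WithLp.toLp 2 v) i).trans (hR _ (hS h1))
    have h4 := le_abs_self (v i)
    rw [Real.norm_eq_abs] at h3
    linarith
  have key := pMean_lintegral_orthant_le hp ht hγ (hΦm hAm) (hΦm hBm) (hΦm hCm) (hgt 0) (hΦle A)
    (hΦle B) (hΦbox subset_union_left) (hΦbox subset_union_right)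
    (by rw [hΦint hAm]; exact ((pos_iff_ne_zero.2 hA0).trans_le hAle).ne')
    (by rw [hΦint hBm]; exact ((pos_iff_ne_zero.2 hB0).trans_le hBle).ne') fun v w hv hw => by
      obtain ⟨hvA, hv0⟩ := hΦne hv
      obtain ⟨hwB, hw0⟩ := hΦne hw
      rw [hΦval hvA, hΦval hwB,
        hΦval (realMean_mem_fireyComb hp ht hA.isCompact hAu hB.isCompact hBu
        hvA hwB (hφo hv0) (hφo hw0))]
      exact pMean_orthantRegularization_le hp ht hgt hg hgc hv0 hw0
  rw [hΦint hAm, hΦint hBm, hΦint hCm] at key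
  refine (pMean_mono ht γ hAle hBle).trans (key.trans ?_)
  rw [hφdef, orthantRegularization, setLIntegral_indicator isOpen_openOrthant.measurableSet,
    inter_comm]
  refine setLIntegral_mono' (hCm.inter isOpen_openOrthant.measurableSet) fun x hx => ?_
  rw [← orthantRegularization_apply g hx.2]
  exact orthantRegularization_le hg x

/-- A measure whose density is antitone along rays vanishes if it vanishes on a neighbourhood of the
origin, because dilates of the neighbourhood cover the space. -/
lemma lintegral_eq_zero_of_setLIntegral_eq_zero
    (hg : ∀ x z, (∀ i, |z i| ≤ |x i|) → g x ≤ g z) {A : Set (EuclideanSpace ℝ (Fin n))}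
    (hA : 0 ∈ interior A) (h0 : ∫⁻ x in A, g x = 0) : ∫⁻ x, g x = 0 := by
  have hcover : (univ : Set (EuclideanSpace ℝ (Fin n))) =
      ⋃ k : ℕ, (fun x => ((k : ℝ) + 1)⁻¹ • x) ⁻¹' A := by
    refine (eq_univ_of_forall fun x => mem_iUnion.2 ?_).symm
    have hlim : Filter.Tendsto (fun k : ℕ => ((k : ℝ) + 1)⁻¹ • x) Filter.atTop (nhds 0) := by
      have := (tendsto_one_div_add_atTop_nhds_zero_nat (𝕜 := ℝ)).smul_const x
      simpa using this
    exact (hlim.eventually (mem_interior_iff_mem_nhds.1 hA)).exists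
  have hk (k : ℕ) : ∫⁻ x in (fun x => ((k : ℝ) + 1)⁻¹ • x) ⁻¹' A, g x = 0 := by
    have hk1 : (1 : ℝ) ≤ (k : ℝ) + 1 := by simp
    rw [setLIntegral_comp_smul (by positivity), mul_eq_zero]
    right
    refine le_antisymm ((lintegral_mono fun x => hg _ _ fun i => ?_).trans h0.le) zero_le
    rw [PiLp.smul_apply, smul_eq_mul, abs_mul, abs_of_pos (by linarith : 0 < (k : ℝ) + 1)]
    exact le_mul_of_one_le_left (abs_nonneg _) hk1
  rw [← setLIntegral_univ, hcover]
  exact le_antisymm ((lintegral_iUnion_le _ _).trans (by simp [hk])) zero_le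

end

end

theorem corollary2p2 (n : ℕ) (hn : 0 < n) (p : ℝ) (hp : p ∈ Icc (0 : ℝ) 1)
    (α : EReal) (hα : ((-(p / n) : ℝ) : EReal) ≤ α)
    (f : EuclideanSpace ℝ (Fin n) → ℝ≥0) (hf : AEMeasurable f volume)
    (hfα : IsAlphaConcave α f)
    (μ : Measure (EuclideanSpace ℝ (Fin n)))
    (hμf : μ = (volume : Measure (EuclideanSpace ℝ (Fin n))).withDensity
      (fun x => (f x : ℝ≥0∞)))
    (hμ : IsUnconditionalMeasure μ)
    (A B : Set (EuclideanSpace ℝ (Fin n)))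
    (hA : IsConvexBodyAtOrigin A) (hAu : IsUnconditionalSet A)
    (hB : IsConvexBodyAtOrigin B) (hBu : IsUnconditionalSet B)
    (t : ℝ) (ht : t ∈ Icc (0 : ℝ) 1) :
    pMean (gammaExp n p α) t (μ A) (μ B) ≤ μ (fireyComb (p : EReal) t A B) := by
  set g := unconditionalMinorant f with hgdef
  have hg : ∀ x z : EuclideanSpace ℝ (Fin n), (∀ i, |z i| ≤ |x i|) → g x ≤ g z :=
    fun x z h => unconditionalMinorant_antitone hfα h
  have hμg : μ = volume.withDensity g :=
    hμf.trans (withDensity_congr_ae (unconditionalMinorant_ae_eq hf (hμf ▸ hμ)).symm)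
  have hac : μ ≪ volume := hμf ▸ withDensity_absolutelyContinuous _ _
  have hAm := hA.isCompact.measurableSet
  have hBm := hB.isCompact.measurableSet
  have hCm := (isClosed_fireyComb A B p t).measurableSet
  have hint {S : Set (EuclideanSpace ℝ (Fin n))} (hS : MeasurableSet S) : μ S = ∫⁻ x in S, g x := by
    rw [hμg, withDensity_apply _ hS]
  have hzero {S : Set (EuclideanSpace ℝ (Fin n))} (hS : IsConvexBodyAtOrigin S) (h : μ S = 0) :
      μ = 0 := by
    rw [hint hS.isCompact.measurableSet] at h
    rw [← Measure.measure_univ_eq_zero, hint .univ, setLIntegral_univ]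
    exact lintegral_eq_zero_of_setLIntegral_eq_zero hg hS.zero_mem_interior h
  by_cases hμ0 : μ = 0
  · simp [hμ0, pMean_self ht]
  have hA0 : μ A ≠ 0 := fun h => hμ0 (hzero hA h)
  have hB0 : μ B ≠ 0 := fun h => hμ0 (hzero hB h)
  rw [measure_eq_card_mul_openOrthant hμ hac hAm hAu] at hA0 ⊢
  rw [measure_eq_card_mul_openOrthant hμ hac hBm hBu] at hB0 ⊢
  rw [measure_eq_card_mul_openOrthant hμ hac hCm (isUnconditionalSet_fireyComb hAu hBu _ _),
    pMean_mul_left ht _ (by simp) (ENNReal.natCast_ne_top _)]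
  have ho := (isOpen_openOrthant (n := n)).measurableSet
  rw [hint (hAm.inter ho)] at hA0 ⊢
  rw [hint (hBm.inter ho)] at hB0 ⊢
  rw [hint (hCm.inter ho)]
  gcongr
  exact pMean_setLIntegral_openOrthant_le hp ht (unconditionalMinorant_ne_top f) hg
    (fun x y hx hy => pMean_unconditionalMinorant_le hfα ht hx hy)
    (isIteratedMarginalExp_gammaExp ht hp hn hα) hA hAu hB hBu (right_ne_zero_of_mul hA0)
    (right_ne_zero_of_mul hB0)
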